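/- Setting. Let $(X,d,\ll,\le,\tau)$ be a Lorentzian pre-length space: $d$ is a metric, $\le$ is a reflexive and transitive relation, $\ll$ is a transitive relation contained in $\le$, and $\tau:X\times X\to[0,\infty]$ is lower semicontinuous, vanishes on pairs with $x\not\le y$, satisfies $\tau(x,y)>0\iff x\ll y$, and satisfies $\tau(x,z)\ge\tau(x,y)+\tau(y,z)$ for $x\le y\le z$. Let $K\in\mathbb R$, let $\mathbb L^2(K)$ be the two-dimensional simply connected Lorentzian model space of constant curvature $K$ (the Minkowski plane for $K=0$, the universal cover of de Sitter space for $K>0$ and of anti-de Sitter space for $K<0$), with its causal relation and time separation, also denoted $\le$ and $\tau$, and let $D_K=\pi/\sqrt{-K}$ if $K<0$ and $D_K=\infty$ if $K\ge0$. A geodesic from $x$ to $y$, for $x\ll y$, is a continuous curve $\gamma:[0,1]\to X$ from $x$ to $y$ with $\tau(\gamma(s),\gamma(t))=(t-s)\,\tau(x,y)$ for $s\le t$. A timelike triangle consists of points $x\ll y\ll z$ with $\tau(x,z)<D_K$ and geodesics $[x,y]$, $[y,z]$, $[x,z]$. An admissible causal triangle consists of $x\le y\le z$ with $x\ll y$ or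 $y\ll z$, with $\tau(x,z)<D_K$, and with geodesics along those sides that are timelike; one of the sides $xy$, $yz$ may be null. A comparison triangle for $x\le y\le z$ consists of $\bar x\le\bar y\le\bar z$ in $\mathbb L^2(K)$ with the same three time separations. The comparison point of a point $p$ on a timelike side $[v,w]$ is the point $\bar p$ of $[\bar v,\bar w]$ with $\tau(\bar v,\bar p)=\tau(v,p)$ and $\tau(\bar p,\bar w)=\tau(p,w)$. Degenerate triangles are allowed. An open set $U\subseteq X$ is a $(\le K)$-comparison neighbourhood in the sense of triangle comparison if 1. $\tau$ is continuous on $(U\times U)\cap\tau^{-1}([0,D_K))$, and this set is open; 2. all $x\ll y$ in $U$ with $\tau(x,y)<D_K$ are joined by a geodesic inside $U$; 3. for every timelike triangle in $U$, all $p,q$ on its sides, every comparison triangle and the comparison points $\bar p,\bar q$, we have $\tau(p,q)\ge\tau(\bar p,\bar q)$. It is one in the sense of strict triangle comparison if (1) and (2) hold and, for every admissible causal triangle in $U$ and all $p,q$ on its timelike sides, we have $\tau(p,q)\ge\tau(\bar p,\bar q)$ and ($\bar p\le\bar q\Rightarrow p\le q$). An open set $U\subseteq X$ is a $(\le K)$-comparison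 neighbourhood in the sense of the four-point condition if (1) holds and * (ii) for all $x_1,x_2,x_3,x_4\in U$ with $x_1\ll x_4$, $\tau(x_1,x_4)<D_K$ and $x_1\ll x_2\ll x_4$, $x_1\ll x_3\ll x_4$: whenever $\Delta(\hat x_1,\hat x_2,\hat x_4)$ and $\Delta(\hat x_1,\hat x_3,\hat x_4)$ are comparison triangles for $\Delta(x_1,x_2,x_4)$ and $\Delta(x_1,x_3,x_4)$ realised on opposite sides of the line through $[\hat x_1,\hat x_4]$, then $\tau(x_2,x_3)\ge\tau(\hat x_2,\hat x_3)$; * (iii) for all $x_1\ll x_2\ll x_3\ll x_4$ in $U$ with $\tau(x_1,x_4)<D_K$: whenever $\Delta(\hat x_1,\hat x_2,\hat x_3)$ and $\Delta(\hat x_2,\hat x_3,\hat x_4)$ are comparison triangles for $\Delta(x_1,x_2,x_3)$ and $\Delta(x_2,x_3,x_4)$ realised on the same side of the line through $[\hat x_2,\hat x_3]$, then $\tau(x_1,x_4)\le\tau(\hat x_1,\hat x_4)$. It is one in the sense of the strict four-point condition if (1) holds and (ii), (iii) hold in the following stronger form. In (ii), the points $x_2,x_3\in U$ range over $(I^+(x_1)\cap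 J^-(x_4))\cup(J^+(x_1)\cap I^-(x_4))$ (that is, for $i=2,3$: $x_1\ll x_i\le x_4$ or $x_1\le x_i\ll x_4$) and the conclusion also includes $\hat x_2\le\hat x_3\Rightarrow x_2\le x_3$. In (iii), the points range over all $x_1\le x_2\ll x_3\le x_4$ in $U$ with $\tau(x_1,x_4)<D_K$. Proposition. If $U$ is a $(\le K)$-comparison neighbourhood in the sense of triangle comparison, then $U$ is a $(\le K)$-comparison neighbourhood in the sense of the four-point condition. If $U$ is a $(\le K)$-comparison neighbourhood in the sense of strict triangle comparison, then $U$ is a $(\le K)$-comparison neighbourhood in the sense of the strict four-point condition. -/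

import Mathlib

noncomputable section

/-- A Lorentzian pre-length space: a metric space with a preorder `Causal` (written `≤` in the
literature), a transitive relation `Chron` (written `≪`) contained in it, and a lower
semicontinuous time separation function `tau` with values in `[0, ∞]` that satisfies the reverse
triangle inequality along causal chains, vanishes off `Causal`, and is positive exactly on
`Chron`. -/
class LorentzianPreLengthSpace (X : Type*) extends MetricSpace X where
  /-- the causal relation `x ≤ y` -/
  Causal : X → X → Prop
  /-- the timelike (chronological) relation `x ≪ y` -/
  Chron : X → X → Prop
  /-- the time separation function -/
  tau : X → X → ENNReal
  causal_refl : ∀ x, Causal x x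
  causal_trans : ∀ x y z, Causal x y → Causal y z → Causal x z
  chron_trans : ∀ x y z, Chron x y → Chron y z → Chron x z
  causal_of_chron : ∀ x y, Chron x y → Causal x y
  tau_lowerSemicontinuous : LowerSemicontinuous (fun p : X × X => tau p.1 p.2)
  tau_triangle : ∀ x y z, Causal x y → Causal y z → tau x y + tau y z ≤ tau x z
  tau_eq_zero : ∀ x y, ¬ Causal x y → tau x y = 0
  tau_pos_iff : ∀ x y, 0 < tau x y ↔ Chron x y

open LorentzianPreLengthSpace (Causal Chron tau)

/-! ### The two-dimensional model spaces -/

/-- The simply connected two-dimensional Lorentzian model space of constant curvature `K`, in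
global conformally flat coordinates `(t, x)` with `x` spacelike:
* `K = 0`: the Minkowski plane, metric `-dt² + dx²`;
* `K > 0`: the universal cover of de Sitter space, the strip `|t| < π/2` with metric
  `(-dt² + dx²) / (K cos² t)`;
* `K < 0`: the universal cover of anti-de Sitter space, the strip `|x| < π/2` with metric
  `(-dt² + dx²) / (|K| cos² x)`. -/
@[ext]
structure LorentzModel (K : ℝ) where
  t : ℝ
  x : ℝ
  t_lt : 0 < K → |t| < Real.pi / 2
  x_lt : K < 0 → |x| < Real.pi / 2

namespace LorentzModel

variable {K : ℝ}

/-- The causal relation of the model space: the metric is conformal to `-dt² + dx²`. -/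
def Causal (p q : LorentzModel K) : Prop := |q.x - p.x| ≤ q.t - p.t

open Classical in
/-- The time separation of the model space, in closed form. On causally related pairs it is
* `√(Δt² - Δx²)` for `K = 0`;
* `arcosh ⟨P, Q⟩ / √K` for `K > 0`, where `⟨P, Q⟩` is the ambient product of the points
  `(tan t, cos x / cos t, sin x / cos t)` of the unit hyperboloid in `ℝ^{1,2}`;
* for `K < 0`, `arccos (-⟨P, Q⟩) / √|K|`, where `⟨P, Q⟩` is the ambient product of the points
  `(cos t / cos x, sin t / cos x, tan x)` of the unit hyperboloid in `ℝ^{2,1}`, as long as `q`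
  is in the causal past of the point `(p.t + π, -p.x)` where all timelike geodesics from `p`
  refocus; beyond that there are arbitrarily long causal curves from `p` to `q`. -/
def tau (p q : LorentzModel K) : ENNReal :=
  if Causal p q then
    if K = 0 then ENNReal.ofReal (√((q.t - p.t) ^ 2 - (q.x - p.x) ^ 2))
    else if 0 < K then
      ENNReal.ofReal (Real.arcosh
        ((Real.cos (q.x - p.x) - Real.sin p.t * Real.sin q.t) / (Real.cos p.t * Real.cos q.t))
          / √K)
    else if q.t - p.t + |p.x + q.x| ≤ Real.pi then
      ENNReal.ofReal (Real.arccos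
        ((Real.cos (q.t - p.t) - Real.sin p.x * Real.sin q.x) / (Real.cos p.x * Real.cos q.x))
          / √(-K))
    else ⊤
  else 0

open Classical in
/-- A positive multiple of the position vector of `p` in the ambient three-dimensional space (for
`K = 0`, in the affine plane at height one). Geodesics are cut out by planes through `0`. -/
def ambient (p : LorentzModel K) : Fin 3 → ℝ :=
  if K = 0 then ![1, p.t, p.x]
  else if 0 < K then ![Real.cos p.x, Real.sin p.x, Real.sin p.t]
  else ![Real.cos p.t, Real.sin p.t, Real.sin p.x]

/-- For `a ≪ b` with `τ(a, b) < D_K`, the sign of `side a b p` tells on which side of the line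
(complete geodesic) through `a` and `b` the point `p` lies; it is zero on the line. (For `K > 0`
this is used, and is correct, for points `p` causally related to a point of the line.) -/
def side (a b p : LorentzModel K) : ℝ :=
  Matrix.det (Matrix.of ![ambient a, ambient b, ambient p])

/-- `p` and `q` lie on opposite sides of the line through `a` and `b`, in the sense of closed half
spaces: a degenerate triangle (a point on the line) counts as lying on either side. -/
def OppositeSides (a b p q : LorentzModel K) : Prop := side a b p * side a b q ≤ 0

/-- `p` and `q` lie on the same side of the line through `a` and `b`, in the sense of closed half
spaces. -/
def SameSide (a b p q : LorentzModel K) : Prop := 0 ≤ side a b p * side a b q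

end LorentzModel

/-- The finite diameter `D_K` of the model space: `π / √(-K)` if `K < 0`, and `∞` otherwise. -/
def finiteDiameter (K : ℝ) : ENNReal :=
  if K < 0 then ENNReal.ofReal (Real.pi / √(-K)) else ⊤

/-! ### Geodesics, comparison triangles and comparison points -/

section Comparison

variable {X : Type*} [LorentzianPreLengthSpace X]

/-- `γ`, restricted to `[0, 1]`, is a geodesic (distance realiser) from `x` to `y` that runs inside
`U` and is parametrised with constant speed. -/
structure IsGeodesicIn (U : Set X) (γ : ℝ → X) (x y : X) : Prop where
  source : γ 0 = x
  target : γ 1 = y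
  continuousOn : ContinuousOn γ (Set.Icc 0 1)
  mem : ∀ s ∈ Set.Icc (0 : ℝ) 1, γ s ∈ U
  tau_eq : ∀ s ∈ Set.Icc (0 : ℝ) 1, ∀ r ∈ Set.Icc (0 : ℝ) 1, s ≤ r →
    tau (γ s) (γ r) = ENNReal.ofReal (r - s) * tau x y

/-- `U` is `D`-geodesic. -/
def IsDGeodesic (U : Set X) (D : ENNReal) : Prop :=
  ∀ x ∈ U, ∀ y ∈ U, Chron x y → tau x y < D → ∃ γ : ℝ → X, IsGeodesicIn U γ x y

/-- `(a, b, c)` is a comparison triangle in the model space for `x ≤ y ≤ z`. -/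
structure IsComparisonTriangle {K : ℝ} (x y z : X) (a b c : LorentzModel K) : Prop where
  causal₁₂ : a.Causal b
  causal₂₃ : b.Causal c
  tau₁₂ : a.tau b = tau x y
  tau₂₃ : b.tau c = tau y z
  tau₁₃ : a.tau c = tau x z

/-- For `p` on a timelike side `[x, y]` and `a`, `b` the comparison vertices of `x`, `y`: `p'` is
the comparison point for `p`, i.e. the point on `[a, b]` with the same time separations from
the endpoints. -/
structure IsComparisonPoint {K : ℝ} (x y p : X) (a b p' : LorentzModel K) : Prop where
  causal_left : a.Causal p'
  causal_right : p'.Causal b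
  tau_left : a.tau p' = tau x p
  tau_right : p'.tau b = tau p y

/-- `p` lies on the side `γ` from `x` to `y`, this side is timelike, and `p'` is the comparison
point for `p` on the corresponding side `[a, b]` of the comparison triangle. -/
def OnTimelikeSide {K : ℝ} (γ : ℝ → X) (x y p : X) (a b p' : LorentzModel K) : Prop :=
  Chron x y ∧ (∃ s ∈ Set.Icc (0 : ℝ) 1, γ s = p) ∧ IsComparisonPoint x y p a b p'

/-- `p` lies on a timelike side of the triangle with vertices `x, y, z` and sides `α = [x, y]`,
`β = [y, z]`, `γ = [x, z]`, and `p'` is the comparison point for `p` on the corresponding side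
of the comparison triangle `(a, b, c)`. -/
def OnTriangle {K : ℝ} (α β γ : ℝ → X) (x y z p : X) (a b c p' : LorentzModel K) : Prop :=
  OnTimelikeSide α x y p a b p' ∨ OnTimelikeSide β y z p b c p' ∨ OnTimelikeSide γ x z p a c p'

/-- A timelike triangle in `U` with vertices `x ≪ y ≪ z`, sides `α = [x, y]`, `β = [y, z]`,
`γ = [x, z]`, satisfying the size bound `τ(x, z) < D`. -/
structure IsTimelikeTriangle (U : Set X) (D : ENNReal) (α β γ : ℝ → X) (x y z : X) : Prop where
  chron₁₂ : Chron x y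
  chron₂₃ : Chron y z
  size : tau x z < D
  side₁₂ : IsGeodesicIn U α x y
  side₂₃ : IsGeodesicIn U β y z
  side₁₃ : IsGeodesicIn U γ x z

/-- An admissible causal triangle in `U`: as a timelike triangle, but one of the sides `[x, y]`,
`[y, z]` may be null. Nothing is required of `α` or `β` if the corresponding side is null. -/
structure IsAdmissibleCausalTriangle (U : Set X) (D : ENNReal) (α β γ : ℝ → X) (x y z : X) :
    Prop where
  mem₁ : x ∈ U
  mem₂ : y ∈ U
  mem₃ : z ∈ U
  causal₁₂ : Causal x y
  causal₂₃ : Causal y z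
  chron_or : Chron x y ∨ Chron y z
  size : tau x z < D
  side₁₂ : Chron x y → IsGeodesicIn U α x y
  side₂₃ : Chron y z → IsGeodesicIn U β y z
  side₁₃ : IsGeodesicIn U γ x z

/-! ### Upper curvature bounds -/

/-- `τ` is continuous on `(U × U) ∩ τ⁻¹([0, D))`, and this set is open. -/
def TauContinuousBelow (U : Set X) (D : ENNReal) : Prop :=
  ContinuousOn (fun p : X × X => tau p.1 p.2) (U ×ˢ U ∩ {p : X × X | tau p.1 p.2 < D}) ∧
    IsOpen (U ×ˢ U ∩ {p : X × X | tau p.1 p.2 < D})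

/-- `U` is a `(≤ K)`-comparison neighbourhood in the sense of triangle comparison. -/
structure TriangleComparison (K : ℝ) (U : Set X) : Prop where
  isOpen : IsOpen U
  tau_continuous : TauContinuousBelow U (finiteDiameter K)
  geodesic : IsDGeodesic U (finiteDiameter K)
  comparison : ∀ (x y z : X) (α β γ : ℝ → X),
    IsTimelikeTriangle U (finiteDiameter K) α β γ x y z →
    ∀ a b c : LorentzModel K, IsComparisonTriangle x y z a b c →
    ∀ (p q : X) (p' q' : LorentzModel K),
      OnTriangle α β γ x y z p a b c p' → OnTriangle α β γ x y z q a b c q' →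
      p'.tau q' ≤ tau p q

/-- `U` is a `(≤ K)`-comparison neighbourhood in the sense of strict triangle comparison. -/
structure StrictTriangleComparison (K : ℝ) (U : Set X) : Prop where
  isOpen : IsOpen U
  tau_continuous : TauContinuousBelow U (finiteDiameter K)
  geodesic : IsDGeodesic U (finiteDiameter K)
  comparison : ∀ (x y z : X) (α β γ : ℝ → X),
    IsAdmissibleCausalTriangle U (finiteDiameter K) α β γ x y z →
    ∀ a b c : LorentzModel K, IsComparisonTriangle x y z a b c →
    ∀ (p q : X) (p' q' : LorentzModel K),
      OnTriangle α β γ x y z p a b c p' → OnTriangle α β γ x y z q a b c q' →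
      p'.tau q' ≤ tau p q ∧ (p'.Causal q' → Causal p q)

/-- `U` is a `(≤ K)`-comparison neighbourhood in the sense of the four-point condition. -/
structure FourPointCondition (K : ℝ) (U : Set X) : Prop where
  isOpen : IsOpen U
  tau_continuous : TauContinuousBelow U (finiteDiameter K)
  opposite : ∀ x₁ ∈ U, ∀ x₂ ∈ U, ∀ x₃ ∈ U, ∀ x₄ ∈ U,
    Chron x₁ x₄ → tau x₁ x₄ < finiteDiameter K →
    Chron x₁ x₂ → Chron x₂ x₄ → Chron x₁ x₃ → Chron x₃ x₄ →
    ∀ a₁ a₂ a₃ a₄ : LorentzModel K,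
      IsComparisonTriangle x₁ x₂ x₄ a₁ a₂ a₄ → IsComparisonTriangle x₁ x₃ x₄ a₁ a₃ a₄ →
      LorentzModel.OppositeSides a₁ a₄ a₂ a₃ →
      a₂.tau a₃ ≤ tau x₂ x₃
  same : ∀ x₁ ∈ U, ∀ x₂ ∈ U, ∀ x₃ ∈ U, ∀ x₄ ∈ U,
    Chron x₁ x₂ → Chron x₂ x₃ → Chron x₃ x₄ → tau x₁ x₄ < finiteDiameter K →
    ∀ a₁ a₂ a₃ a₄ : LorentzModel K,
      IsComparisonTriangle x₁ x₂ x₃ a₁ a₂ a₃ → IsComparisonTriangle x₂ x₃ x₄ a₂ a₃ a₄ →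
      LorentzModel.SameSide a₂ a₃ a₁ a₄ →
      tau x₁ x₄ ≤ a₁.tau a₄

/-- `U` is a `(≤ K)`-comparison neighbourhood in the sense of the strict four-point condition. -/
structure StrictFourPointCondition (K : ℝ) (U : Set X) : Prop where
  isOpen : IsOpen U
  tau_continuous : TauContinuousBelow U (finiteDiameter K)
  opposite : ∀ x₁ ∈ U, ∀ x₂ ∈ U, ∀ x₃ ∈ U, ∀ x₄ ∈ U,
    Chron x₁ x₄ → tau x₁ x₄ < finiteDiameter K →
    (Chron x₁ x₂ ∧ Causal x₂ x₄ ∨ Causal x₁ x₂ ∧ Chron x₂ x₄) →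
    (Chron x₁ x₃ ∧ Causal x₃ x₄ ∨ Causal x₁ x₃ ∧ Chron x₃ x₄) →
    ∀ a₁ a₂ a₃ a₄ : LorentzModel K,
      IsComparisonTriangle x₁ x₂ x₄ a₁ a₂ a₄ → IsComparisonTriangle x₁ x₃ x₄ a₁ a₃ a₄ →
      LorentzModel.OppositeSides a₁ a₄ a₂ a₃ →
      (a₂.Causal a₃ → Causal x₂ x₃) ∧ a₂.tau a₃ ≤ tau x₂ x₃
  same : ∀ x₁ ∈ U, ∀ x₂ ∈ U, ∀ x₃ ∈ U, ∀ x₄ ∈ U,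
    Causal x₁ x₂ → Chron x₂ x₃ → Causal x₃ x₄ → tau x₁ x₄ < finiteDiameter K →
    ∀ a₁ a₂ a₃ a₄ : LorentzModel K,
      IsComparisonTriangle x₁ x₂ x₃ a₁ a₂ a₃ → IsComparisonTriangle x₂ x₃ x₄ a₂ a₃ a₄ →
      LorentzModel.SameSide a₂ a₃ a₁ a₄ →
      tau x₁ x₄ ≤ a₁.tau a₄

end Comparison

end

/-! Opposite sides. If `a₂ ≤ a₃`, the segment from `a₂` to `a₃` meets the segment `[a₁, a₄]` in a
point `r`. Let `p` be the point of a geodesic from `x₁` to `x₄` with comparison point `r`.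
Comparison in the two triangles gives `τ(a₂, r) ≤ τ(x₂, p)` and `τ(r, a₃) ≤ τ(p, x₃)`, and the
reverse triangle inequality adds them. Under strict comparison the causal relations are composed in
the same way.

Same side. Suppose `τ(x₁, x₄) > τ(a₁, a₄)`. The diagonals `[a₁, a₃]` and `[a₂, a₄]` meet in a point
`r` between `a₂` and `a₃`. If `r ≠ a₃`, let `p` correspond to `r` on a geodesic from `x₁` to `x₃`.
Then `τ(x₂, p) ≥ τ(a₂, r)`. A comparison triangle of `x₁, x₃, x₄` has a longer side `x₁x₄` than the
triangle `a₁, a₃, a₄` and the same other sides, so by hinge monotonicity `τ(p, x₄) > τ(r, a₄)`.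
Adding yields `τ(x₂, x₄) > τ(a₂, a₄)`, a contradiction. If `r = a₃`, the time-reversed argument is
applied on a geodesic from `x₂` to `x₄`.

Non-strict comparison gives no causal relation when `r` coincides with a vertex. There lower
semicontinuity of `τ` along the geodesic yields `τ(p, w) ≤ τ(x₂, w)` for all `w`, or its time dual,
which is all that the addition needs (`tau_add_le`).

The model geometry is algebra in null coordinates, uniform in the sign of `K`. The quantity `chord`
is the squared generalised sine of half the time separation, and lines are planes in homogeneous
coordinates. Stewart's theorem makes chords affine along a segment; it gives additivity of length
(`IsComb.exists_add`) and hinge monotonicity (`exists_longer_triangle`). Crossings come from sign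
changes of `det3` (`exists_crossing`, `exists_diagonal_crossing`). -/

noncomputable section

/-! ### Algebra in null coordinates

A point of a model space of curvature of sign `-ε` is described by null coordinates `(u, v)` in
which the metric is a constant multiple of `-du dv / (1 + ε u v)²`. -/

namespace NullChart

/-- The conformal weight of the point `p`. -/
def wt (ε : ℝ) (p : ℝ × ℝ) : ℝ := 1 + ε * p.1 * p.2

/-- The third homogeneous coordinate of `p`, besides its two null coordinates. -/
def co (ε : ℝ) (p : ℝ × ℝ) : ℝ := 1 - ε * p.1 * p.2

/-- The squared chord between `p` and `q`: the square of the generalised sine of half of the time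
separation. -/
def chord (ε : ℝ) (p q : ℝ × ℝ) : ℝ :=
  (q.1 - p.1) * (q.2 - p.2) / (wt ε p * wt ε q)

/-- The determinant of the homogeneous coordinates of three points. -/
def det3 (ε : ℝ) (p q r : ℝ × ℝ) : ℝ :=
  co ε p * (q.1 * r.2 - q.2 * r.1) - p.1 * (co ε q * r.2 - q.2 * co ε r)
    + p.2 * (co ε q * r.1 - q.1 * co ε r)

/-- The homogeneous coordinates of `r` are a linear combination of those of `p` and `q`. -/
structure IsComb (ε α β : ℝ) (p q r : ℝ × ℝ) : Prop where
  co : co ε r = α * co ε p + β * co ε q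
  fst : r.1 = α * p.1 + β * q.1
  snd : r.2 = α * p.2 + β * q.2

/-- `p` precedes `q` and the weight is positive on the diamond between them. -/
structure Good (ε : ℝ) (p q : ℝ × ℝ) : Prop where
  fst_le : p.1 ≤ q.1
  snd_le : p.2 ≤ q.2
  left : 0 < 1 + ε * p.1 * p.2
  right : 0 < 1 + ε * q.1 * q.2
  corner : 0 < 1 + ε * p.1 * q.2
  corner' : 0 < 1 + ε * q.1 * p.2

/-- `r` lies in the diamond between `p` and `q`. -/
structure Between (p q r : ℝ × ℝ) : Prop where
  fst_left : p.1 ≤ r.1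
  fst_right : r.1 ≤ q.1
  snd_left : p.2 ≤ r.2
  snd_right : r.2 ≤ q.2

theorem affine_pos {c d a b u : ℝ} (ha : a ≤ u) (hb : u ≤ b) (h₁ : 0 < c + d * a)
    (h₂ : 0 < c + d * b) : 0 < c + d * u := by
  rcases le_total 0 d with h | h
  · nlinarith [mul_le_mul_of_nonneg_left ha h]
  · nlinarith [mul_le_mul_of_nonpos_left hb h]

variable {ε : ℝ} {p q r : ℝ × ℝ}

/-- The weight is affine in each null coordinate separately, so its sign on a rectangle is
controlled by the four corners. -/
theorem Good.pos (h : Good ε p q) {u v : ℝ} (hu : p.1 ≤ u) (hu' : u ≤ q.1) (hv : p.2 ≤ v)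
    (hv' : v ≤ q.2) : 0 < 1 + ε * u * v := by
  have h₁ : 0 < 1 + ε * p.1 * v := affine_pos hv hv' h.left h.corner
  have h₂ : 0 < 1 + ε * q.1 * v := affine_pos hv hv' h.corner' h.right
  have h₃ : 0 < 1 + ε * v * u :=
    affine_pos hu hu' (by linarith [mul_right_comm ε p.1 v]) (by linarith [mul_right_comm ε q.1 v])
  linarith [mul_right_comm ε u v]

theorem Good.wt_pos (h : Good ε p q) (hr : Between p q r) : 0 < wt ε r :=
  h.pos hr.fst_left hr.fst_right hr.snd_left hr.snd_right

theorem Good.between_left (h : Good ε p q) : Between p q p := ⟨le_rfl, h.fst_le, le_rfl, h.snd_le⟩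

theorem Good.between_right (h : Good ε p q) : Between p q q := ⟨h.fst_le, le_rfl, h.snd_le, le_rfl⟩

theorem Good.sub (h : Good ε p q) {p' q' : ℝ × ℝ} (hp : Between p q p') (hq : Between p q q')
    (h₁ : p'.1 ≤ q'.1) (h₂ : p'.2 ≤ q'.2) : Good ε p' q' where
  fst_le := h₁
  snd_le := h₂
  left := h.wt_pos hp
  right := h.wt_pos hq
  corner := h.pos hp.fst_left hp.fst_right hq.snd_left hq.snd_right
  corner' := h.pos hq.fst_left hq.fst_right hp.snd_left hp.snd_right

theorem Good.chord_nonneg (h : Good ε p q) : 0 ≤ chord ε p q :=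
  div_nonneg (mul_nonneg (sub_nonneg.2 h.fst_le) (sub_nonneg.2 h.snd_le))
    (mul_pos h.left h.right).le

/-- This number is the squared generalised cosine of the half-length. Its numerator is the product
of the two mixed corner weights. -/
theorem Good.chord_lt (h : Good ε p q) : 0 < 1 - ε * chord ε p q := by
  have hl : 0 < wt ε p := h.left
  have hr : 0 < wt ε q := h.right
  have : 1 - ε * chord ε p q =
      (1 + ε * p.1 * q.2) * (1 + ε * q.1 * p.2) / (wt ε p * wt ε q) := by
    rw [chord]
    field_simp
    rw [wt, wt]
    ring
  rw [this]
  exact div_pos (mul_pos h.corner h.corner') (mul_pos hl hr)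

theorem Good.chord_pos_iff (h : Good ε p q) : 0 < chord ε p q ↔ p.1 < q.1 ∧ p.2 < q.2 := by
  have hl : 0 < wt ε p * wt ε q := mul_pos h.left h.right
  constructor
  · intro h'
    refine ⟨lt_of_le_of_ne h.fst_le ?_, lt_of_le_of_ne h.snd_le ?_⟩ <;> intro e <;>
      simp [chord, e] at h'
  · rintro ⟨h₁, h₂⟩
    exact div_pos (mul_pos (sub_pos.2 h₁) (sub_pos.2 h₂)) hl

theorem chord_self (ε : ℝ) (p : ℝ × ℝ) : chord ε p p = 0 := by simp [chord]

theorem chord_comm (ε : ℝ) (p q : ℝ × ℝ) : chord ε p q = chord ε q p := by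
  rw [chord, chord, mul_comm (wt ε p)]
  ring

/-- In this factored form only coordinate differences and mixed corner weights occur, so
collinearity in a diamond can be read off from signs. -/
theorem det3_eq (ε : ℝ) (p q r : ℝ × ℝ) : det3 ε p q r =
    (r.2 - p.2) * (q.1 - r.1) * (1 + ε * p.1 * q.2)
      - (r.1 - p.1) * (q.2 - r.2) * (1 + ε * q.1 * p.2) := by
  simp only [det3, co]
  ring

theorem IsComb.det3_eq {α β : ℝ} (h : IsComb ε α β p q r) (a b : ℝ × ℝ) :
    det3 ε a b r = α * det3 ε a b p + β * det3 ε a b q := by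
  simp only [det3]
  rw [h.co, h.fst, h.snd]
  ring

theorem det3_self_left (ε : ℝ) (p q : ℝ × ℝ) : det3 ε p q p = 0 := by
  simp only [det3]
  ring

theorem det3_self_right (ε : ℝ) (p q : ℝ × ℝ) : det3 ε p q q = 0 := by
  simp only [det3]
  ring

theorem IsComb.det3_eq_zero {α β : ℝ} (h : IsComb ε α β p q r) : det3 ε p q r = 0 := by
  rw [h.det3_eq, det3_self_left, det3_self_right]
  ring

/-- A point of a timelike diamond on the line through its tips is a nonnegative combination of
the tips. -/
theorem Good.exists_isComb (h : Good ε p q) (h₁ : p.1 < q.1) (h₂ : p.2 < q.2)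
    (hr : Between p q r) (hd : det3 ε p q r = 0) :
    ∃ α β, 0 ≤ α ∧ 0 ≤ β ∧ IsComb ε α β p q r ∧
      (r = p ∨ p.1 < r.1 ∧ p.2 < r.2) ∧ (r = q ∨ 0 < α ∧ r.1 < q.1 ∧ r.2 < q.2) := by
  have hX := h.corner
  have hY := h.corner'
  have hq : 0 < q.2 - p.2 := sub_pos.2 h₂
  have hq' : 0 < q.1 - p.1 := sub_pos.2 h₁
  have hA : 0 < 1 + ε * r.1 * q.2 := h.pos hr.fst_left hr.fst_right h.snd_le le_rfl
  have hB : 0 < 1 + ε * r.1 * p.2 := h.pos hr.fst_left hr.fst_right le_rfl h.snd_le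
  have hD₁ := mul_pos hq hX
  have hD₂ := mul_pos hq hY
  rw [NullChart.det3_eq] at hd
  -- Each coefficient is found by applying a linear functional that vanishes on the null line `x.2 =
  -- const` through the other tip, and dividing by its value at the tip in question.
  refine ⟨(q.2 - r.2) * (1 + ε * r.1 * q.2) / ((q.2 - p.2) * (1 + ε * p.1 * q.2)),
    (r.2 - p.2) * (1 + ε * r.1 * p.2) / ((q.2 - p.2) * (1 + ε * q.1 * p.2)), ?_, ?_, ?_, ?_, ?_⟩
  · exact div_nonneg (mul_nonneg (sub_nonneg.2 hr.snd_right) hA.le) (mul_pos hq hX).le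
  · exact div_nonneg (mul_nonneg (sub_nonneg.2 hr.snd_left) hB.le) (mul_pos hq hY).le
  · constructor
    · simp only [NullChart.co]
      rw [div_mul_eq_mul_div, div_mul_eq_mul_div, div_add_div _ _ hD₁.ne' hD₂.ne',
        eq_div_iff (mul_pos hD₁ hD₂).ne']
      linear_combination ε * (p.2 + q.2) * (q.2 - p.2) * hd
    · rw [div_mul_eq_mul_div, div_mul_eq_mul_div, div_add_div _ _ hD₁.ne' hD₂.ne',
        eq_div_iff (mul_pos hD₁ hD₂).ne']
      linear_combination -(q.2 - p.2) * hd
    · rw [div_mul_eq_mul_div, div_mul_eq_mul_div, div_add_div _ _ hD₁.ne' hD₂.ne',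
        eq_div_iff (mul_pos hD₁ hD₂).ne']
      linear_combination ε * p.2 * q.2 * (q.2 - p.2) * hd
  -- A timelike line meets a null line through `p` only in `p`: if one null coordinate of `r` agrees
  -- with that of `p`, the vanishing determinant makes the other agree.
  · rcases hr.snd_left.eq_or_lt with e | e
    · left
      rw [← e] at hd
      have : (r.1 - p.1) * ((q.2 - p.2) * (1 + ε * q.1 * p.2)) = 0 := by linear_combination -hd
      have := (mul_eq_zero.1 this).resolve_right (mul_pos hq hY).ne'
      exact Prod.ext (by linarith) e.symm
    · right
      refine ⟨lt_of_le_of_ne hr.fst_left fun e' => ?_, e⟩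
      rw [← e'] at hd
      have : (r.2 - p.2) * ((q.1 - p.1) * (1 + ε * p.1 * q.2)) = 0 := by linear_combination hd
      have := (mul_eq_zero.1 this).resolve_right (mul_pos hq' hX).ne'
      linarith
  · rcases hr.snd_right.eq_or_lt with e | e
    · left
      rw [e] at hd
      have : (q.1 - r.1) * ((q.2 - p.2) * (1 + ε * p.1 * q.2)) = 0 := by linear_combination hd
      have := (mul_eq_zero.1 this).resolve_right (mul_pos hq hX).ne'
      exact Prod.ext (by linarith) e
    · right
      refine ⟨div_pos (mul_pos (sub_pos.2 e) hA) (mul_pos hq hX),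
        lt_of_le_of_ne hr.fst_right fun e' => ?_, e⟩
      rw [e'] at hd
      have : (q.2 - r.2) * ((q.1 - p.1) * (1 + ε * q.1 * p.2)) = 0 := by linear_combination -hd
      have := (mul_eq_zero.1 this).resolve_right (mul_pos hq' hY).ne'
      linarith

/-- A parametrisation by `[0, 1]` of the segment from `p` to `q`. -/
def seg (ε : ℝ) (p q : ℝ × ℝ) (y : ℝ) : ℝ × ℝ :=
  (((1 - y) * p.1 + y * (1 + ε * p.1 * q.2) * q.1) / (1 - y + y * (1 + ε * p.1 * q.2)),
    ((1 - y) * p.2 + y * (1 + ε * q.1 * p.2) * q.2) / (1 - y + y * (1 + ε * q.1 * p.2)))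

theorem one_sub_add_mul_pos {y X : ℝ} (h₀ : 0 ≤ y) (h₁ : y ≤ 1) (hX : 0 < X) :
    0 < 1 - y + y * X := by
  rcases h₀.eq_or_lt with rfl | h
  · simp
  · nlinarith [mul_pos h hX]

theorem Good.between_seg (h : Good ε p q) {y : ℝ} (h₀ : 0 ≤ y) (h₁ : y ≤ 1) :
    Between p q (seg ε p q y) := by
  have hX := one_sub_add_mul_pos h₀ h₁ h.corner
  have hY := one_sub_add_mul_pos h₀ h₁ h.corner'
  have a₁ := mul_nonneg (mul_nonneg h₀ h.corner.le) (sub_nonneg.2 h.fst_le)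
  have a₂ := mul_nonneg (sub_nonneg.2 h₁) (sub_nonneg.2 h.fst_le)
  have a₃ := mul_nonneg (mul_nonneg h₀ h.corner'.le) (sub_nonneg.2 h.snd_le)
  have a₄ := mul_nonneg (sub_nonneg.2 h₁) (sub_nonneg.2 h.snd_le)
  constructor <;> simp only [seg]
  · rw [le_div_iff₀ hX]
    linear_combination a₁
  · rw [div_le_iff₀ hX]
    linear_combination a₂
  · rw [le_div_iff₀ hY]
    linear_combination a₃
  · rw [div_le_iff₀ hY]
    linear_combination a₄

/-- The corner weights inserted in `seg` are exactly those that cancel in the factored determinant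
`det3_eq`, so the point is collinear with the tips. The scale `ρ` is the product of the two
denominators of `seg`. -/
theorem Good.isComb_seg (h : Good ε p q) {y : ℝ} (h₀ : 0 ≤ y) (h₁ : y ≤ 1) :
    ∃ ρ : ℝ, 0 < ρ ∧ IsComb ε (((1 - y) ^ 2 + y * (1 - y) * wt ε q) / ρ)
      ((y * (1 - y) * wt ε p + y ^ 2 * ((1 + ε * p.1 * q.2) * (1 + ε * q.1 * p.2))) / ρ)
      p q (seg ε p q y) := by
  have hX := one_sub_add_mul_pos h₀ h₁ h.corner
  have hY := one_sub_add_mul_pos h₀ h₁ h.corner'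
  refine ⟨_, mul_pos hX hY, ?_⟩
  constructor
  · simp only [co, seg, wt]
    rw [mul_assoc ε (_ / _), div_mul_div_comm, div_mul_eq_mul_div, div_mul_eq_mul_div, ← add_div,
      eq_div_iff (mul_pos hX hY).ne', sub_mul, mul_assoc ε (_ / _), div_mul_cancel₀ _ (mul_pos hX hY).ne']
    ring
  · simp only [seg, wt]
    rw [div_mul_eq_mul_div, div_mul_eq_mul_div, ← add_div,
      div_eq_div_iff hX.ne' (mul_pos hX hY).ne']
    ring
  · simp only [seg, wt]
    rw [div_mul_eq_mul_div, div_mul_eq_mul_div, ← add_div,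
      div_eq_div_iff hY.ne' (mul_pos hX hY).ne']
    ring

theorem seg_zero (ε : ℝ) (p q : ℝ × ℝ) : seg ε p q 0 = p := by simp [seg]

theorem Good.seg_one (h : Good ε p q) : seg ε p q 1 = q := by
  have hX := h.corner
  have hY := h.corner'
  ext
  · simp only [seg]
    rw [div_eq_iff (by linarith)]
    ring
  · simp only [seg]
    rw [div_eq_iff (by linarith)]
    ring

theorem Good.continuousOn_seg (h : Good ε p q) : ContinuousOn (seg ε p q) (Set.Icc 0 1) := by
  unfold seg
  refine ContinuousOn.prodMk (ContinuousOn.div (by fun_prop) (by fun_prop) ?_)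
    (ContinuousOn.div (by fun_prop) (by fun_prop) ?_)
  · intro y hy
    exact (one_sub_add_mul_pos hy.1 hy.2 h.corner).ne'
  · intro y hy
    exact (one_sub_add_mul_pos hy.1 hy.2 h.corner').ne'

/-- Every nonnegative combination of two causally related points is, up to a positive factor, a
point of the segment between them. -/
theorem Good.exists_ratio (h : Good ε p q) {l m : ℝ} (hl : 0 ≤ l) (hm : 0 ≤ m) :
    ∃ r, Between p q r ∧ ∃ α β, 0 ≤ α ∧ 0 ≤ β ∧ 0 < α + β ∧ α * m = β * l ∧
      IsComb ε α β p q r := by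
  have hp : 0 < wt ε p := h.left
  have hq : 0 < wt ε q := h.right
  have hXY := mul_pos h.corner h.corner'
  -- Up to the factor `ρ`, `f` is `α * m - β * l` along `seg`. It goes from `m ≥ 0` at `y = 0` to a
  -- nonpositive multiple of `l` at `y = 1`.
  set f : ℝ → ℝ := fun y => ((1 - y) ^ 2 + y * (1 - y) * wt ε q) * m -
    (y * (1 - y) * wt ε p + y ^ 2 * ((1 + ε * p.1 * q.2) * (1 + ε * q.1 * p.2))) * l with hf
  have hc : ContinuousOn f (Set.Icc 0 1) := by
    rw [hf]
    fun_prop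
  have h0 : (0 : ℝ) ∈ Set.Icc (f 1) (f 0) := by
    simp only [hf]
    constructor
    · nlinarith [mul_nonneg hXY.le hl]
    · linarith
  obtain ⟨y, ⟨hy₀, hy₁⟩, hy⟩ := intermediate_value_Icc' zero_le_one hc h0
  obtain ⟨ρ, hρ, hcomb⟩ := h.isComb_seg hy₀ hy₁
  have hy' : 0 ≤ 1 - y := sub_nonneg.2 hy₁
  have ha : 0 ≤ (1 - y) ^ 2 + y * (1 - y) * wt ε q := by positivity
  have hb : 0 ≤ y * (1 - y) * wt ε p +
    y ^ 2 * ((1 + ε * p.1 * q.2) * (1 + ε * q.1 * p.2)) := by positivity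
  refine ⟨_, h.between_seg hy₀ hy₁, _, _, div_nonneg ha hρ.le, div_nonneg hb hρ.le, ?_, ?_, hcomb⟩
  · rw [← add_div]
    refine div_pos ?_ hρ
    rcases hy'.eq_or_lt with e | e
    · have : y = 1 := by linarith
      subst this
      nlinarith
    · have : 0 < (1 - y) ^ 2 := by positivity
      have : 0 ≤ y * (1 - y) * wt ε q := by positivity
      linarith
  · simp only [hf] at hy
    field_simp
    linear_combination hy

/-- A segment contains points at every chord from its past endpoint up to the full chord. -/
theorem Good.exists_chord_eq (h : Good ε p q) {S : ℝ} (hS : 0 ≤ S) (hS' : S ≤ chord ε p q) :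
    ∃ r, Between p q r ∧ chord ε p r = S ∧ ∃ α β, 0 ≤ α ∧ 0 ≤ β ∧ IsComb ε α β p q r := by
  have hp : 0 < wt ε p := h.left
  have hc : ContinuousOn (fun y => chord ε p (seg ε p q y)) (Set.Icc 0 1) := by
    have h₁ := h.continuousOn_seg
    have h₂ := h₁.fst
    have h₃ := h₁.snd
    refine ContinuousOn.div (by fun_prop) (by unfold wt; fun_prop) fun y hy => ?_
    exact (mul_pos hp (h.wt_pos (h.between_seg hy.1 hy.2))).ne'
  have h0 : S ∈ Set.Icc (chord ε p (seg ε p q 0)) (chord ε p (seg ε p q 1)) := by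
    rw [seg_zero, h.seg_one, chord_self]
    exact ⟨hS, hS'⟩
  obtain ⟨y, ⟨hy₀, hy₁⟩, hy⟩ := intermediate_value_Icc zero_le_one hc h0
  obtain ⟨ρ, hρ, hcomb⟩ := h.isComb_seg hy₀ hy₁
  have hy' : 0 ≤ 1 - y := sub_nonneg.2 hy₁
  have hq : 0 < wt ε q := h.right
  have hXY := mul_pos h.corner h.corner'
  exact ⟨_, h.between_seg hy₀ hy₁, hy, _, _, by positivity, by positivity, hcomb⟩

/-- Stewart's theorem: the chord from a variable point to a point of a segment is an affine
combination of its chords to the endpoints. -/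
theorem IsComb.stewart {α β : ℝ} (h : IsComb ε α β p q r) (hα : 0 ≤ α) (hβ : 0 ≤ β)
    (hp : 0 < wt ε p) (hq : 0 < wt ε q) (hr : 0 < wt ε r) :
    ∃ k l m : ℝ, 0 ≤ l ∧ 0 ≤ m ∧ (0 < α → 0 < l) ∧ 2 * ε * k = 1 - l - m ∧
      ∀ x, 0 < wt ε x → chord ε r x = k + l * chord ε p x + m * chord ε q x := by
  have hco := h.co
  simp only [NullChart.co] at hco
  -- Cleared of weights, a chord is linear in the null coordinates of `r` except for a constant term
  -- and the product `r.1 * r.2`. `k` records the defect of the product, and the relation for `co`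
  -- ties the defect of the constant to it.
  refine ⟨(r.1 * r.2 - α * (p.1 * p.2) - β * (q.1 * q.2)) / wt ε r, α * wt ε p / wt ε r,
    β * wt ε q / wt ε r, by positivity, by positivity, fun _ => by positivity, ?_, ?_⟩
  · field_simp
    simp only [wt]
    linear_combination -hco
  · intro x hx
    simp only [chord]
    field_simp
    simp only [wt]
    linear_combination x.1 * x.2 * hco - x.2 * h.fst - x.1 * h.snd

/-- Heron's formula for a degenerate triangle, with the chords expressed through the
generalised sines and cosines of the half-lengths. -/
theorem heron {ε k l m S₁ S₂ S s₁ c₁ s₂ c₂ : ℝ} (hl : 0 ≤ l) (hm : 0 ≤ m)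
    (hS : 0 < 1 - ε * S)
    (e : 2 * ε * k = 1 - l - m) (e₁ : S₁ = k + m * S) (e₂ : S₂ = k + l * S)
    (e₃ : 0 = k + l * S₁ + m * S₂) (hs₁ : s₁ ^ 2 = S₁) (hs₂ : s₂ ^ 2 = S₂)
    (hc₁ : c₁ ^ 2 = 1 - ε * S₁) (hc₂ : c₂ ^ 2 = 1 - ε * S₂) (h₁ : 0 ≤ s₁) (h₂ : 0 ≤ s₂)
    (h₃ : 0 < c₁) (h₄ : 0 < c₂) :
    (s₁ * c₂ + c₁ * s₂) ^ 2 = S ∧ 0 < c₁ * c₂ - ε * s₁ * s₂ := by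
  have hS₁ : 0 ≤ S₁ := hs₁ ▸ sq_nonneg _
  have hS₂ : 0 ≤ S₂ := hs₂ ▸ sq_nonneg _
  have hk : k ≤ 0 := by nlinarith [mul_nonneg hl hS₁, mul_nonneg hm hS₂]
  have f₁ : 2 * k * (1 - ε * S) = S₁ + S₂ - S := by linear_combination -S * e - e₁ - e₂
  have f₂ : k * (S - S₁ - S₂) = -2 * S₁ * S₂ := by
    linear_combination -S * e₃ + S₁ * e₂ + S₂ * e₁
  have hge : S₁ + S₂ ≤ S := by nlinarith
  have f₃ : (S - S₁ - S₂) ^ 2 = 4 * S₁ * S₂ * (1 - ε * S) := by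
    linear_combination (S - S₁ - S₂) * f₁ - 2 * (1 - ε * S) * f₂
  -- `f₃` is Heron's relation, equivalent to the squared identity `f₆`. The sign `f₄` permits the
  -- square root `f₇`, which is the addition theorem. For `k = 0` one of `S₁`, `S₂` vanishes;
  -- otherwise the sign is read off after multiplying by `-k > 0`.
  have f₄ : 0 ≤ S - S₁ - S₂ + 2 * ε * S₁ * S₂ := by
    rcases hk.eq_or_lt with h | h
    · rw [h] at f₂
      have : S₁ * S₂ = 0 := by linarith
      have : 2 * ε * S₁ * S₂ = 0 := by linear_combination 2 * ε * this
      linarith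
    · have f₅ : -k * (S - S₁ - S₂ + 2 * ε * S₁ * S₂) = S₁ * S₂ * (1 + l + m) := by
        linear_combination -f₂ - S₁ * S₂ * e
      have : 0 ≤ -k * (S - S₁ - S₂ + 2 * ε * S₁ * S₂) := by rw [f₅]; positivity
      exact nonneg_of_mul_nonneg_right this (by linarith)
  have f₆ : (S - S₁ - S₂ + 2 * ε * S₁ * S₂) ^ 2 = (2 * (s₁ * s₂) * (c₁ * c₂)) ^ 2 := by
    have : (2 * (s₁ * s₂) * (c₁ * c₂)) ^ 2 = 4 * (s₁ ^ 2 * s₂ ^ 2) * (c₁ ^ 2 * c₂ ^ 2) := by ring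
    rw [this, hs₁, hs₂, hc₁, hc₂]
    linear_combination f₃
  have f₇ : S - S₁ - S₂ + 2 * ε * S₁ * S₂ = 2 * (s₁ * s₂) * (c₁ * c₂) :=
    (pow_left_inj₀ f₄ (by positivity) two_ne_zero).1 f₆
  refine ⟨?_, ?_⟩
  · have : (s₁ * c₂ + c₁ * s₂) ^ 2 =
      s₁ ^ 2 * c₂ ^ 2 + c₁ ^ 2 * s₂ ^ 2 + 2 * (s₁ * s₂) * (c₁ * c₂) := by ring
    rw [this, hs₁, hs₂, hc₁, hc₂]
    linear_combination -f₇
  · rcases (mul_nonneg h₁ h₂).eq_or_lt with h | h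
    · have : ε * s₁ * s₂ = 0 := by rw [mul_assoc, ← h, mul_zero]
      rw [this, sub_zero]
      positivity
    · have f₈ : 2 * (s₁ * s₂) * (c₁ * c₂ - ε * s₁ * s₂) = S - S₁ - S₂ := by
        rw [← hs₁, ← hs₂] at f₇ ⊢
        linear_combination -f₇
      have hk' : k ≠ 0 := by
        rintro rfl
        have : 0 < (s₁ * s₂) ^ 2 := by positivity
        rw [mul_pow, hs₁, hs₂] at this
        linarith
      have hk'' : k < 0 := lt_of_le_of_ne hk hk'
      have : 0 < S - S₁ - S₂ := by nlinarith
      rw [← f₈] at this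
      exact pos_of_mul_pos_right this (by positivity)

end NullChart

/-! ### Generalised trigonometric functions -/

namespace NullChart

/-- Minus the sign of the curvature. -/
def ep (K : ℝ) : ℝ := if K = 0 then 0 else if 0 < K then -1 else 1

/-- The generalised sine. -/
def sn (K θ : ℝ) : ℝ :=
  if K = 0 then θ else if 0 < K then Real.sinh (√K * θ) else Real.sin (√(-K) * θ)

/-- The generalised cosine. -/
def cs (K θ : ℝ) : ℝ :=
  if K = 0 then 1 else if 0 < K then Real.cosh (√K * θ) else Real.cos (√(-K) * θ)

/-- `θ` is nonnegative and less than half of the finite diameter. -/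
def InRange (K θ : ℝ) : Prop := 0 ≤ θ ∧ (K < 0 → √(-K) * θ < Real.pi / 2)

variable {K θ φ : ℝ}

theorem sn_add (K θ φ : ℝ) : sn K (θ + φ) = sn K θ * cs K φ + cs K θ * sn K φ := by
  unfold sn cs
  split_ifs
  · ring
  · rw [mul_add, Real.sinh_add]
  · rw [mul_add, Real.sin_add]

theorem cs_add (K θ φ : ℝ) : cs K (θ + φ) = cs K θ * cs K φ - ep K * sn K θ * sn K φ := by
  unfold sn cs ep
  split_ifs
  · ring
  · rw [mul_add, Real.cosh_add]
    ring
  · rw [mul_add, Real.cos_add]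
    ring

theorem cs_sq (K θ : ℝ) : cs K θ ^ 2 = 1 - ep K * sn K θ ^ 2 := by
  unfold sn cs ep
  split_ifs
  · ring
  · rw [Real.cosh_sq]
    ring
  · rw [Real.cos_sq']
    ring

theorem sn_zero (K : ℝ) : sn K 0 = 0 := by simp [sn]

theorem InRange.zero (K : ℝ) : InRange K 0 :=
  ⟨le_rfl, fun _ => by rw [mul_zero]; exact Real.pi_div_two_pos⟩

theorem InRange.mono (h : InRange K θ) (h₀ : 0 ≤ φ) (h₁ : φ ≤ θ) : InRange K φ :=
  ⟨h₀, fun hK => (mul_le_mul_of_nonneg_left h₁ (Real.sqrt_nonneg _)).trans_lt (h.2 hK)⟩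

theorem InRange.cs_pos (h : InRange K θ) : 0 < cs K θ := by
  unfold cs
  split_ifs with h₁ h₂
  · exact one_pos
  · exact Real.cosh_pos _
  · have hK : K < 0 := lt_of_le_of_ne (not_lt.1 h₂) h₁
    have := mul_nonneg (Real.sqrt_nonneg (-K)) h.1
    exact Real.cos_pos_of_mem_Ioo ⟨by linarith [Real.pi_pos], h.2 hK⟩

theorem InRange.strictMono (h₀ : 0 ≤ φ) (h : φ < θ) (hθ : InRange K θ) : sn K φ < sn K θ := by
  unfold sn
  split_ifs with h₁ h₂
  · exact h
  · exact Real.sinh_lt_sinh.2 (mul_lt_mul_of_pos_left h (Real.sqrt_pos.2 h₂))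
  · have hK : K < 0 := lt_of_le_of_ne (not_lt.1 h₂) h₁
    have := mul_nonneg (Real.sqrt_nonneg (-K)) h₀
    exact Real.sin_lt_sin_of_lt_of_le_pi_div_two (by linarith [Real.pi_pos]) (hθ.2 hK).le
      (mul_lt_mul_of_pos_left h (Real.sqrt_pos.2 (neg_pos.2 hK)))

theorem InRange.sn_nonneg (h : InRange K θ) : 0 ≤ sn K θ := by
  rcases h.1.eq_or_lt with e | e
  · rw [← e, sn_zero]
  · exact (sn_zero K ▸ InRange.strictMono le_rfl e h).le

theorem InRange.sn_sq_lt_iff (hφ : InRange K φ) (hθ : InRange K θ) :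
    sn K φ ^ 2 < sn K θ ^ 2 ↔ φ < θ := by
  rw [pow_lt_pow_iff_left₀ hφ.sn_nonneg hθ.sn_nonneg two_ne_zero]
  refine ⟨fun h => ?_, fun h => InRange.strictMono hφ.1 h hθ⟩
  by_contra h'
  rcases (not_lt.1 h').eq_or_lt with e | e
  · rw [e] at h
    exact h.false
  · exact (InRange.strictMono hθ.1 e hφ).not_gt h

theorem InRange.sn_sq_le_iff (hφ : InRange K φ) (hθ : InRange K θ) :
    sn K φ ^ 2 ≤ sn K θ ^ 2 ↔ φ ≤ θ :=
  le_iff_le_iff_lt_iff_lt.2 (hθ.sn_sq_lt_iff hφ)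

theorem InRange.sn_sq_inj (hφ : InRange K φ) (hθ : InRange K θ)
    (h : sn K φ ^ 2 = sn K θ ^ 2) : φ = θ :=
  le_antisymm ((hφ.sn_sq_le_iff hθ).1 h.le) ((hθ.sn_sq_le_iff hφ).1 h.ge)

theorem InRange.sn_sq_pos_iff (h : InRange K θ) : 0 < sn K θ ^ 2 ↔ 0 < θ := by
  have := (InRange.zero K).sn_sq_lt_iff h
  rwa [sn_zero, zero_pow two_ne_zero] at this

theorem InRange.sn_sq_lt (h : InRange K θ) : 0 < 1 - ep K * sn K θ ^ 2 := by
  rw [← cs_sq]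
  exact pow_pos h.cs_pos 2

/-- For `K < 0` the sum of the two rescaled half-lengths is less than `π`, and on that range a
positive cosine means an angle below `π / 2`. -/
theorem InRange.add (hθ : InRange K θ) (hφ : InRange K φ) (h : 0 < cs K (θ + φ)) :
    InRange K (θ + φ) := by
  refine ⟨add_nonneg hθ.1 hφ.1, fun hK => ?_⟩
  by_contra h'
  rw [not_lt] at h'
  have h₁ := hθ.2 hK
  have h₂ := hφ.2 hK
  rw [cs, if_neg hK.ne, if_neg hK.not_gt] at h
  rw [mul_add] at h h'
  exact h.not_ge (Real.cos_nonpos_of_pi_div_two_le_of_le h' (by linarith))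

/-- The square of the generalised sine is onto. -/
theorem exists_inRange {S : ℝ} (h₀ : 0 ≤ S) (h₁ : 0 < 1 - ep K * S) :
    ∃ θ, InRange K θ ∧ sn K θ ^ 2 = S := by
  unfold ep at h₁
  unfold sn
  split_ifs at h₁ ⊢ with h₂ h₃
  · exact ⟨√S, ⟨Real.sqrt_nonneg _, fun h => absurd h₂ h.ne⟩, Real.sq_sqrt h₀⟩
  · have hs := Real.sqrt_pos.2 h₃
    refine ⟨Real.arsinh (√S) / √K, ⟨div_nonneg (Real.arsinh_nonneg_iff.2 (Real.sqrt_nonneg _))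
      hs.le, fun h => absurd h₃ h.not_gt⟩, ?_⟩
    rw [mul_div_cancel₀ _ hs.ne', Real.sinh_arsinh, Real.sq_sqrt h₀]
  · have hK : K < 0 := lt_of_le_of_ne (not_lt.1 h₃) h₂
    have hs := Real.sqrt_pos.2 (neg_pos.2 hK)
    have hS : √S < 1 := by
      rw [Real.sqrt_lt' one_pos]
      linarith
    refine ⟨Real.arcsin (√S) / √(-K), ⟨div_nonneg (Real.arcsin_nonneg.2 (Real.sqrt_nonneg _))
      hs.le, fun _ => ?_⟩, ?_⟩
    · rw [mul_div_cancel₀ _ hs.ne']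
      exact Real.arcsin_lt_pi_div_two.2 hS
    · rw [mul_div_cancel₀ _ hs.ne', Real.sin_arcsin (by linarith [Real.sqrt_nonneg S]) hS.le,
        Real.sq_sqrt h₀]

theorem ofReal_two_mul_lt_finiteDiameter_iff (h₀ : 0 ≤ θ) :
    ENNReal.ofReal (2 * θ) < finiteDiameter K ↔ InRange K θ := by
  unfold finiteDiameter InRange
  split_ifs with h
  · have hs := Real.sqrt_pos.2 (neg_pos.2 h)
    rw [ENNReal.ofReal_lt_ofReal_iff (div_pos Real.pi_pos hs), lt_div_iff₀ hs]
    constructor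
    · intro h'
      exact ⟨h₀, fun _ => by linarith⟩
    · intro h'
      linarith [h'.2 h]
  · exact ⟨fun _ => ⟨h₀, fun h' => absurd h' h⟩, fun _ => ENNReal.ofReal_lt_top⟩

end NullChart

/-! ### Null coordinates on the model spaces -/

namespace NullChart

open LorentzModel

/-- The point `a` of the model space has null coordinates `p`, in the chart centred at the
origin moved by `c` along the homogeneous coordinate direction. -/
def IsChart {K : ℝ} (c : ℝ) (a : LorentzModel K) (p : ℝ × ℝ) : Prop :=
  if K = 0 then a.t = p.1 + p.2 ∧ a.x = p.1 - p.2
  else if 0 < K then a.t = Real.arctan p.1 + Real.arctan p.2 ∧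
    a.x = c + (Real.arctan p.1 - Real.arctan p.2)
  else a.t = c + (Real.arctan p.1 + Real.arctan p.2) ∧ a.x = Real.arctan p.1 - Real.arctan p.2

theorem sin_arctan_eq (u : ℝ) : Real.sin (Real.arctan u) = u * Real.cos (Real.arctan u) := by
  rw [Real.sin_arctan, Real.cos_arctan]
  ring

theorem cos_arctan_add (u v : ℝ) : Real.cos (Real.arctan u + Real.arctan v) =
    Real.cos (Real.arctan u) * Real.cos (Real.arctan v) * (1 - u * v) := by
  rw [Real.cos_add, sin_arctan_eq, sin_arctan_eq]
  ring

theorem sin_arctan_add (u v : ℝ) : Real.sin (Real.arctan u + Real.arctan v) =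
    Real.cos (Real.arctan u) * Real.cos (Real.arctan v) * (u + v) := by
  rw [Real.sin_add, sin_arctan_eq, sin_arctan_eq]
  ring

theorem cos_arctan_sub (u v : ℝ) : Real.cos (Real.arctan u - Real.arctan v) =
    Real.cos (Real.arctan u) * Real.cos (Real.arctan v) * (1 + u * v) := by
  rw [Real.cos_sub, sin_arctan_eq, sin_arctan_eq]
  ring

theorem sin_arctan_sub (u v : ℝ) : Real.sin (Real.arctan u - Real.arctan v) =
    Real.cos (Real.arctan u) * Real.cos (Real.arctan v) * (u - v) := by
  rw [Real.sin_sub, sin_arctan_eq, sin_arctan_eq]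
  ring

theorem abs_lt_pi_div_two_iff {s : ℝ} (h : |s| < Real.pi) :
    |s| < Real.pi / 2 ↔ 0 < Real.cos s := by
  constructor
  · intro h'
    exact Real.cos_pos_of_mem_Ioo (abs_lt.1 h')
  · intro h'
    by_contra hc
    rw [← Real.cos_abs] at h'
    exact h'.not_ge (Real.cos_nonpos_of_pi_div_two_le_of_le (not_lt.1 hc)
      (by linarith [Real.pi_pos]))

/-- This turns the strip conditions that define the model spaces into positivity of a weight. A sum
of two arctangents stays below `π` in absolute value, where the sign of the cosine decides. -/
theorem abs_arctan_add_lt_iff (u v : ℝ) :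
    |Real.arctan u + Real.arctan v| < Real.pi / 2 ↔ 0 < 1 - u * v := by
  have h : |Real.arctan u + Real.arctan v| < Real.pi := by
    rw [abs_lt]
    constructor <;> linarith [Real.arctan_lt_pi_div_two u, Real.arctan_lt_pi_div_two v,
      Real.neg_pi_div_two_lt_arctan u, Real.neg_pi_div_two_lt_arctan v]
  rw [abs_lt_pi_div_two_iff h, cos_arctan_add]
  exact mul_pos_iff_of_pos_left (mul_pos (Real.cos_arctan_pos u) (Real.cos_arctan_pos v))

theorem abs_arctan_sub_lt_iff (u v : ℝ) :
    |Real.arctan u - Real.arctan v| < Real.pi / 2 ↔ 0 < 1 + u * v := by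
  have := abs_arctan_add_lt_iff u (-v)
  rwa [Real.arctan_neg, ← sub_eq_add_neg, mul_neg, sub_neg_eq_add] at this

variable {K c : ℝ} {a b d : LorentzModel K} {p q r : ℝ × ℝ}

theorem wt_ep_eq (K : ℝ) (u v : ℝ) : 1 + ep K * u * v =
    if K = 0 then 1 else if 0 < K then 1 - u * v else 1 + u * v := by
  unfold ep
  split_ifs <;> ring

theorem IsChart.wt_pos (h : IsChart c a p) : 0 < 1 + ep K * p.1 * p.2 := by
  rw [wt_ep_eq]
  unfold IsChart at h
  split_ifs at h ⊢ with h₁ h₂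
  · exact one_pos
  · rw [← abs_arctan_add_lt_iff, ← h.1]
    exact a.t_lt h₂
  · rw [← abs_arctan_sub_lt_iff, ← h.2]
    exact a.x_lt (lt_of_le_of_ne (not_lt.1 h₂) h₁)

theorem IsChart.causal_iff (ha : IsChart c a p) (hb : IsChart c b q) :
    a.Causal b ↔ p.1 ≤ q.1 ∧ p.2 ≤ q.2 := by
  unfold LorentzModel.Causal
  unfold IsChart at ha hb
  rw [abs_le]
  have h₁ : p.1 ≤ q.1 ↔ Real.arctan p.1 ≤ Real.arctan q.1 :=
    Real.arctan_strictMono.le_iff_le.symm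
  have h₂ : p.2 ≤ q.2 ↔ Real.arctan p.2 ≤ Real.arctan q.2 :=
    Real.arctan_strictMono.le_iff_le.symm
  split_ifs at ha hb with hK hK'
  · rw [ha.1, ha.2, hb.1, hb.2]
    constructor <;> rintro ⟨h, h'⟩ <;> constructor <;> linarith
  · rw [h₁, h₂, ha.1, ha.2, hb.1, hb.2]
    constructor <;> rintro ⟨h, h'⟩ <;> constructor <;> linarith
  · rw [h₁, h₂, ha.1, ha.2, hb.1, hb.2]
    constructor <;> rintro ⟨h, h'⟩ <;> constructor <;> linarith

theorem exists_isChart (K c : ℝ) (h : 0 < 1 + ep K * p.1 * p.2) :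
    ∃ a : LorentzModel K, IsChart c a p := by
  rw [wt_ep_eq] at h
  unfold IsChart
  rcases lt_trichotomy K 0 with hK | hK | hK
  · rw [if_neg hK.ne, if_neg hK.not_gt, ← abs_arctan_sub_lt_iff] at h
    simp only [if_neg hK.ne, if_neg hK.not_gt]
    exact ⟨⟨_, _, fun h' => absurd h' hK.not_gt, fun _ => h⟩, rfl, rfl⟩
  · simp only [if_pos hK]
    exact ⟨⟨_, _, fun h' => absurd hK h'.ne', fun h' => absurd hK h'.ne⟩, rfl, rfl⟩
  · rw [if_neg hK.ne', if_pos hK, ← abs_arctan_add_lt_iff] at h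
    simp only [if_neg hK.ne', if_pos hK]
    exact ⟨⟨_, _, fun _ => h, fun h' => absurd h' hK.not_gt⟩, rfl, rfl⟩

/-- The time separation in null coordinates. -/
theorem IsChart.tau_eq (ha : IsChart c a p) (hb : IsChart c b q) (h : Good (ep K) p q) :
    ∃ θ, InRange K θ ∧ sn K θ ^ 2 = chord (ep K) p q ∧ a.tau b = ENNReal.ofReal (2 * θ) := by
  obtain ⟨θ, hθ, hs⟩ := exists_inRange (K := K) h.chord_nonneg h.chord_lt
  refine ⟨θ, hθ, hs, ?_⟩
  have hab : a.Causal b := (ha.causal_iff hb).2 ⟨h.fst_le, h.snd_le⟩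
  have hp := h.left
  have hq := h.right
  have hc' := h.corner
  have hc := h.corner'
  have hS : chord (ep K) p q * ((1 + ep K * p.1 * p.2) * (1 + ep K * q.1 * q.2)) =
      (q.1 - p.1) * (q.2 - p.2) := div_mul_cancel₀ _ (mul_pos hp hq).ne'
  rw [wt_ep_eq] at hp hq hc hc'
  rw [wt_ep_eq, wt_ep_eq, ← hs] at hS
  unfold LorentzModel.tau
  rw [if_pos hab]
  unfold IsChart at ha hb
  unfold sn at hs hS
  have k₁ := Real.cos_arctan_pos p.1
  have k₂ := Real.cos_arctan_pos p.2
  have k₃ := Real.cos_arctan_pos q.1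
  have k₄ := Real.cos_arctan_pos q.2
  -- For `K = 0` the Minkowski form is `(2θ)²`. For `K ≠ 0`, `hS` turns the quotient in `tau` into a
  -- double-angle formula, `cosh` or `cos` of twice the rescaled half-length. The last case, beyond
  -- the refocusing point, contradicts positivity of the mixed corner weights.
  split_ifs at ha hb hs hS hp hq hc hc' ⊢ with hK hK' hr
  · congr 1
    rw [ha.1, ha.2, hb.1, hb.2, show (q.1 + q.2 - (p.1 + p.2)) ^ 2 - (q.1 - q.2 - (p.1 - p.2)) ^ 2
      = (2 * θ) ^ 2 by linear_combination -4 * hS]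
    exact Real.sqrt_sq (by linarith [hθ.1])
  · congr 1
    have hsK := Real.sqrt_pos.2 hK'
    have : (Real.cos (b.x - a.x) - Real.sin a.t * Real.sin b.t) / (Real.cos a.t * Real.cos b.t) =
        Real.cosh (2 * (√K * θ)) := by
      rw [show b.x - a.x = (Real.arctan q.1 - Real.arctan q.2) -
        (Real.arctan p.1 - Real.arctan p.2) by rw [ha.2, hb.2]; ring, Real.cos_sub, ha.1, hb.1,
        cos_arctan_sub, cos_arctan_sub, sin_arctan_sub, sin_arctan_sub, cos_arctan_add,
        cos_arctan_add, sin_arctan_add, sin_arctan_add, Real.cosh_two_mul, Real.cosh_sq,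
        div_eq_iff (by positivity)]
      linear_combination (-2 * Real.cos (Real.arctan p.1) * Real.cos (Real.arctan p.2) *
        Real.cos (Real.arctan q.1) * Real.cos (Real.arctan q.2)) * hS
    rw [this, Real.arcosh_cosh (by have := hθ.1; positivity)]
    field_simp
  · congr 1
    have hK0 : K < 0 := lt_of_le_of_ne (not_lt.1 hK') hK
    have hsK := Real.sqrt_pos.2 (neg_pos.2 hK0)
    have : (Real.cos (b.t - a.t) - Real.sin a.x * Real.sin b.x) / (Real.cos a.x * Real.cos b.x) =
        Real.cos (2 * (√(-K) * θ)) := by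
      rw [show b.t - a.t = (Real.arctan q.1 + Real.arctan q.2) -
        (Real.arctan p.1 + Real.arctan p.2) by rw [ha.1, hb.1]; ring, Real.cos_sub, ha.2, hb.2,
        cos_arctan_sub, cos_arctan_sub, sin_arctan_sub, sin_arctan_sub, cos_arctan_add,
        cos_arctan_add, sin_arctan_add, sin_arctan_add, Real.cos_two_mul, Real.cos_sq',
        div_eq_iff (by positivity)]
      linear_combination (2 * Real.cos (Real.arctan p.1) * Real.cos (Real.arctan p.2) *
        Real.cos (Real.arctan q.1) * Real.cos (Real.arctan q.2)) * hS
    rw [this, Real.arccos_cos (by have := hθ.1; positivity) (by linarith [hθ.2 hK0])]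
    field_simp
  · exfalso
    apply hr
    rw [← abs_arctan_sub_lt_iff, abs_lt] at hc hc'
    rw [← le_sub_iff_add_le', abs_le, ha.1, ha.2, hb.1, hb.2]
    constructor <;> linarith [hc.1, hc.2, hc'.1, hc'.2]

/-- Every causal diamond of diameter less than the finite diameter lies in a null chart. -/
theorem exists_chart (hab : a.Causal b) (hD : a.tau b < finiteDiameter K) :
    ∃ c p q, IsChart c a p ∧ IsChart c b q ∧ Good (ep K) p q ∧
      ∀ d : LorentzModel K, a.Causal d → d.Causal b → ∃ r, IsChart c d r := by
  have hrefl : ∀ e : LorentzModel K, e.Causal e := fun e => by simp [LorentzModel.Causal]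
  suffices H : ∃ c, (∀ d : LorentzModel K, a.Causal d → d.Causal b → ∃ r, IsChart c d r) ∧
      ∀ p q, IsChart c a p → IsChart c b q →
        0 < 1 + ep K * p.1 * q.2 ∧ 0 < 1 + ep K * q.1 * p.2 by
    obtain ⟨c, h₁, h₂⟩ := H
    obtain ⟨p, hp⟩ := h₁ a (hrefl a) hab
    obtain ⟨q, hq⟩ := h₁ b hab (hrefl b)
    obtain ⟨h₃, h₄⟩ := (hp.causal_iff hq).1 hab
    obtain ⟨h₅, h₆⟩ := h₂ p q hp hq
    exact ⟨c, p, q, hp, hq, ⟨h₃, h₄, hp.wt_pos, hq.wt_pos, h₅, h₆⟩, h₁⟩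
  rcases lt_trichotomy K 0 with hK | hK | hK
  · have hlt : b.t - a.t + |a.x + b.x| < Real.pi := by
      rw [LorentzModel.tau, if_pos hab, if_neg hK.ne, if_neg hK.not_gt, finiteDiameter,
        if_pos hK] at hD
      split_ifs at hD with h
      -- Equality would put `b` on the past light cone of the refocusing point of `a`, where the
      -- quotient is `-1` and the time separation is exactly `D_K`.
      · refine lt_of_le_of_ne h fun e => ?_
        have hax := Real.cos_pos_of_mem_Ioo (abs_lt.1 (a.x_lt hK))
        have hbx := Real.cos_pos_of_mem_Ioo (abs_lt.1 (b.x_lt hK))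
        rw [show b.t - a.t = Real.pi - |a.x + b.x| by linarith, Real.cos_pi_sub, Real.cos_abs,
          Real.cos_add, show (-(Real.cos a.x * Real.cos b.x - Real.sin a.x * Real.sin b.x) -
            Real.sin a.x * Real.sin b.x) / (Real.cos a.x * Real.cos b.x) = -1 by
              rw [div_eq_iff (mul_pos hax hbx).ne']; ring, Real.arccos_neg_one] at hD
        exact hD.false
      · exact absurd le_top hD.not_ge
    have hpi := Real.pi_pos
    have hlt₁ : b.t - a.t + (a.x + b.x) < Real.pi := by linarith [le_abs_self (a.x + b.x)]
    have hlt₂ : b.t - a.t - (a.x + b.x) < Real.pi := by linarith [neg_abs_le (a.x + b.x)]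
    have ht : b.t - a.t < Real.pi := by linarith
    have hab' := abs_le.1 hab
    have hax := abs_lt.1 (a.x_lt hK)
    have hbx := abs_lt.1 (b.x_lt hK)
    -- Centring the chart at the mean time keeps the halved null coordinates of the diamond inside
    -- `(-π/2, π/2)`, where `arctan` inverts `tan`. For `K > 0` the mean of the spatial coordinates
    -- plays this role.
    refine ⟨(a.t + b.t) / 2, fun d had hdb => ?_, fun p q hp hq => ?_⟩
    · have hdx := abs_lt.1 (d.x_lt hK)
      have h₁ := abs_le.1 had
      have h₂ := abs_le.1 hdb
      refine ⟨(Real.tan ((d.t - (a.t + b.t) / 2 + d.x) / 2),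
        Real.tan ((d.t - (a.t + b.t) / 2 - d.x) / 2)), ?_⟩
      simp only [IsChart, if_neg hK.ne, if_neg hK.not_gt]
      rw [Real.arctan_tan (by linarith) (by linarith), Real.arctan_tan (by linarith) (by linarith)]
      constructor <;> ring
    · simp only [IsChart, if_neg hK.ne, if_neg hK.not_gt] at hp hq
      rw [wt_ep_eq, wt_ep_eq, if_neg hK.ne, if_neg hK.not_gt, ← abs_arctan_sub_lt_iff,
        if_neg hK.ne, if_neg hK.not_gt, ← abs_arctan_sub_lt_iff, abs_lt, abs_lt]
      refine ⟨⟨?_, ?_⟩, ?_, ?_⟩ <;> linarith [hp.1, hp.2, hq.1, hq.2]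
  · refine ⟨0, fun d _ _ => ⟨((d.t + d.x) / 2, (d.t - d.x) / 2), ?_⟩, fun p q _ _ => ?_⟩
    · simp only [IsChart, if_pos hK]
      constructor <;> ring
    · rw [wt_ep_eq, wt_ep_eq, if_pos hK, if_pos hK]
      exact ⟨one_pos, one_pos⟩
  · have hat := abs_lt.1 (a.t_lt hK)
    have hbt := abs_lt.1 (b.t_lt hK)
    have hab' := abs_le.1 hab
    refine ⟨(a.x + b.x) / 2, fun d had hdb => ?_, fun p q hp hq => ?_⟩
    · have hdt := abs_lt.1 (d.t_lt hK)
      have h₁ := abs_le.1 had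
      have h₂ := abs_le.1 hdb
      refine ⟨(Real.tan ((d.t + (d.x - (a.x + b.x) / 2)) / 2),
        Real.tan ((d.t - (d.x - (a.x + b.x) / 2)) / 2)), ?_⟩
      simp only [IsChart, if_neg hK.ne', if_pos hK]
      rw [Real.arctan_tan (by linarith) (by linarith), Real.arctan_tan (by linarith) (by linarith)]
      constructor <;> ring
    · obtain ⟨h₁, h₂⟩ := (hp.causal_iff hq).1 hab
      rw [← Real.arctan_strictMono.le_iff_le] at h₁ h₂
      simp only [IsChart, if_neg hK.ne', if_pos hK] at hp hq
      rw [wt_ep_eq, wt_ep_eq, if_neg hK.ne', if_pos hK, ← abs_arctan_add_lt_iff,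
        if_neg hK.ne', if_pos hK, ← abs_arctan_add_lt_iff, abs_lt, abs_lt]
      refine ⟨⟨?_, ?_⟩, ?_, ?_⟩ <;> linarith [hp.1, hp.2, hq.1, hq.2]

/-- The side of a line in null coordinates. -/
theorem IsChart.side_eq (ha : IsChart c a p) (hb : IsChart c b q) (hd : IsChart c d r) :
    ∃ m > 0, side a b d = (if 0 < K then 1 else -1) * m * det3 (ep K) p q r := by
  unfold side ambient
  unfold IsChart at ha hb hd
  have k₁ := Real.cos_arctan_pos p.1
  have k₂ := Real.cos_arctan_pos p.2
  have k₃ := Real.cos_arctan_pos q.1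
  have k₄ := Real.cos_arctan_pos q.2
  have k₅ := Real.cos_arctan_pos r.1
  have k₆ := Real.cos_arctan_pos r.2
  rcases lt_trichotomy K 0 with hK | hK | hK
  · simp only [if_neg hK.ne, if_neg hK.not_gt] at ha hb hd ⊢
    refine ⟨2 * (Real.cos (Real.arctan p.1) * Real.cos (Real.arctan p.2) *
        Real.cos (Real.arctan q.1) * Real.cos (Real.arctan q.2) *
        Real.cos (Real.arctan r.1) * Real.cos (Real.arctan r.2)), by positivity, ?_⟩
    rw [Matrix.det_fin_three]
    simp only [Matrix.of_apply, Matrix.cons_val]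
    rw [ha.1, ha.2, hb.1, hb.2, hd.1, hd.2]
    simp only [Real.cos_add c, Real.sin_add c, cos_arctan_add, sin_arctan_add, sin_arctan_sub]
    simp only [det3, co, ep, if_neg hK.ne, if_neg hK.not_gt]
    generalize Real.cos (Real.arctan p.1) = C₁
    generalize Real.cos (Real.arctan p.2) = C₂
    generalize Real.cos (Real.arctan q.1) = C₃
    generalize Real.cos (Real.arctan q.2) = C₄
    generalize Real.cos (Real.arctan r.1) = C₅
    generalize Real.cos (Real.arctan r.2) = C₆
    -- Moving the chart by `c` rotates the ambient vectors; the determinant of that rotation is the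
    -- sum of squares in `hsc`.
    have hsc := Real.sin_sq_add_cos_sq c
    generalize Real.sin c = s at hsc ⊢
    generalize Real.cos c = k at hsc ⊢
    linear_combination (-1 * (2 * (C₁ * C₂ * C₃ * C₄ * C₅ * C₆)) *
      ((1 - 1 * p.1 * p.2) * (q.1 * r.2 - q.2 * r.1) -
        p.1 * ((1 - 1 * q.1 * q.2) * r.2 - q.2 * (1 - 1 * r.1 * r.2)) +
        p.2 * ((1 - 1 * q.1 * q.2) * r.1 - q.1 * (1 - 1 * r.1 * r.2)))) * hsc
  · simp only [if_pos hK] at ha hb hd ⊢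
    refine ⟨2, by positivity, ?_⟩
    rw [Matrix.det_fin_three]
    simp only [Matrix.of_apply, Matrix.cons_val]
    rw [ha.1, ha.2, hb.1, hb.2, hd.1, hd.2]
    simp only [det3, co, ep, hK, lt_irrefl, if_false, if_true]
    ring
  · simp only [if_neg hK.ne', if_pos hK] at ha hb hd ⊢
    refine ⟨2 * (Real.cos (Real.arctan p.1) * Real.cos (Real.arctan p.2) *
        Real.cos (Real.arctan q.1) * Real.cos (Real.arctan q.2) *
        Real.cos (Real.arctan r.1) * Real.cos (Real.arctan r.2)), by positivity, ?_⟩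
    rw [Matrix.det_fin_three]
    simp only [Matrix.of_apply, Matrix.cons_val]
    rw [ha.1, ha.2, hb.1, hb.2, hd.1, hd.2]
    simp only [Real.cos_add c, Real.sin_add c, cos_arctan_sub, sin_arctan_add, sin_arctan_sub]
    simp only [det3, co, ep, if_neg hK.ne', if_pos hK]
    generalize Real.cos (Real.arctan p.1) = C₁
    generalize Real.cos (Real.arctan p.2) = C₂
    generalize Real.cos (Real.arctan q.1) = C₃
    generalize Real.cos (Real.arctan q.2) = C₄
    generalize Real.cos (Real.arctan r.1) = C₅
    generalize Real.cos (Real.arctan r.2) = C₆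
    have hsc := Real.sin_sq_add_cos_sq c
    generalize Real.sin c = s at hsc ⊢
    generalize Real.cos c = k at hsc ⊢
    linear_combination ((2 * (C₁ * C₂ * C₃ * C₄ * C₅ * C₆)) *
      ((1 - -1 * p.1 * p.2) * (q.1 * r.2 - q.2 * r.1) -
        p.1 * ((1 - -1 * q.1 * q.2) * r.2 - q.2 * (1 - -1 * r.1 * r.2)) +
        p.2 * ((1 - -1 * q.1 * q.2) * r.1 - q.1 * (1 - -1 * r.1 * r.2)))) * hsc

/-- Products of sides with respect to two lines have the same sign as products of determinants. -/
theorem IsChart.side_mul_side {a' b' d' : LorentzModel K} {p' q' r' : ℝ × ℝ}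
    (ha : IsChart c a p) (hb : IsChart c b q) (hd : IsChart c d r)
    (ha' : IsChart c a' p') (hb' : IsChart c b' q') (hd' : IsChart c d' r') :
    ∃ m > 0, side a b d * side a' b' d' = m * (det3 (ep K) p q r * det3 (ep K) p' q' r') := by
  obtain ⟨m, hm, h⟩ := ha.side_eq hb hd
  obtain ⟨m', hm', h'⟩ := ha'.side_eq hb' hd'
  refine ⟨m * m', mul_pos hm hm', ?_⟩
  rw [h, h']
  split_ifs <;> ring

end NullChart

/-! ### Geometry of the model spaces -/

namespace NullChart

open LorentzModel

variable {K c : ℝ} {a b d : LorentzModel K} {p q r : ℝ × ℝ}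

/-- The half-lengths of the two parts of a segment add up. -/
theorem IsComb.exists_add {α β : ℝ} (hc : IsComb (ep K) α β p q r) (hα : 0 ≤ α) (hβ : 0 ≤ β)
    (h : Good (ep K) p q) (hr : Between p q r) :
    ∃ θ φ, InRange K θ ∧ InRange K φ ∧ InRange K (θ + φ) ∧ sn K θ ^ 2 = chord (ep K) p r ∧
      sn K φ ^ 2 = chord (ep K) r q ∧ sn K (θ + φ) ^ 2 = chord (ep K) p q := by
  have h₁ := h.sub h.between_left hr hr.fst_left hr.snd_left
  have h₂ := h.sub hr h.between_right hr.fst_right hr.snd_right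
  have hp := h.wt_pos h.between_left
  have hq := h.wt_pos h.between_right
  obtain ⟨θ, hθ, e₁⟩ := exists_inRange (K := K) h₁.chord_nonneg h₁.chord_lt
  obtain ⟨φ, hφ, e₂⟩ := exists_inRange (K := K) h₂.chord_nonneg h₂.chord_lt
  obtain ⟨k, l, m, hl, hm, -, e, hst⟩ := hc.stewart hα hβ hp hq (h.wt_pos hr)
  have f₁ := hst p hp
  have f₂ := hst q hq
  have f₃ := hst r (h.wt_pos hr)
  rw [chord_self, mul_zero, add_zero, chord_comm _ r, chord_comm _ q] at f₁
  rw [chord_self, mul_zero, add_zero] at f₂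
  rw [chord_self, chord_comm _ q] at f₃
  obtain ⟨g₁, g₂⟩ := heron hl hm h.chord_lt e f₁ f₂ f₃ e₁ e₂ (e₁ ▸ cs_sq K θ) (e₂ ▸ cs_sq K φ)
    hθ.sn_nonneg hφ.sn_nonneg hθ.cs_pos hφ.cs_pos
  rw [← cs_add] at g₂
  exact ⟨θ, φ, hθ, hφ, hθ.add hφ g₂, e₁, e₂, by rw [sn_add, g₁]⟩

theorem IsChart.tau_eq_ofReal (ha : IsChart c a p) (hb : IsChart c b q) (h : Good (ep K) p q)
    {θ : ℝ} (hθ : InRange K θ) (e : sn K θ ^ 2 = chord (ep K) p q) :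
    a.tau b = ENNReal.ofReal (2 * θ) := by
  obtain ⟨φ, hφ, e', h'⟩ := ha.tau_eq hb h
  rw [h', hθ.sn_sq_inj hφ (e.trans e'.symm)]

theorem IsChart.tau_pos_iff (ha : IsChart c a p) (hb : IsChart c b q) (h : Good (ep K) p q) :
    0 < a.tau b ↔ p.1 < q.1 ∧ p.2 < q.2 := by
  obtain ⟨φ, hφ, e, h'⟩ := ha.tau_eq hb h
  rw [h', ENNReal.ofReal_pos, ← h.chord_pos_iff, ← e, hφ.sn_sq_pos_iff]
  constructor <;> intro h <;> linarith

theorem IsChart.ext (ha : IsChart c a p) (hb : IsChart c b p) : a = b := by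
  unfold IsChart at ha hb
  split_ifs at ha hb
  · exact LorentzModel.ext (ha.1.trans hb.1.symm) (ha.2.trans hb.2.symm)
  · exact LorentzModel.ext (ha.1.trans hb.1.symm) (ha.2.trans hb.2.symm)
  · exact LorentzModel.ext (ha.1.trans hb.1.symm) (ha.2.trans hb.2.symm)

theorem IsChart.tau_add {α β : ℝ} (hc : IsComb (ep K) α β p q r) (hα : 0 ≤ α) (hβ : 0 ≤ β)
    (h : Good (ep K) p q) (hr : Between p q r) (ha : IsChart c a p) (hd : IsChart c d r)
    (hb : IsChart c b q) : a.tau d + d.tau b = a.tau b := by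
  obtain ⟨θ, φ, hθ, hφ, hs, e₁, e₂, e⟩ := hc.exists_add hα hβ h hr
  rw [ha.tau_eq_ofReal hd (h.sub h.between_left hr hr.fst_left hr.snd_left) hθ e₁,
    hd.tau_eq_ofReal hb (h.sub hr h.between_right hr.fst_right hr.snd_right) hφ e₂,
    ha.tau_eq_ofReal hb h hs e, mul_add, ENNReal.ofReal_add (by linarith [hθ.1])
      (by linarith [hφ.1])]

theorem IsChart.det3_eq_zero_iff (ha : IsChart c a p) (hb : IsChart c b q) (hd : IsChart c d r) :
    side a b d = 0 ↔ det3 (ep K) p q r = 0 := by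
  obtain ⟨m, hm, h⟩ := ha.side_eq hb hd
  rw [h]
  have : (if 0 < K then (1 : ℝ) else -1) ≠ 0 := by split_ifs <;> norm_num
  exact mul_eq_zero.trans (or_iff_right (mul_ne_zero this hm.ne'))

theorem causal_refl (a : LorentzModel K) : a.Causal a := by simp [LorentzModel.Causal]

theorem causal_trans (h : a.Causal b) (h' : b.Causal d) : a.Causal d := by
  unfold LorentzModel.Causal at *
  rw [abs_le] at *
  constructor <;> linarith

theorem IsChart.between (ha : IsChart c a p) (hb : IsChart c b q) (hd : IsChart c d r)
    (h : a.Causal d) (h' : d.Causal b) : Between p q r := by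
  obtain ⟨h₁, h₂⟩ := (ha.causal_iff hd).1 h
  obtain ⟨h₃, h₄⟩ := (hd.causal_iff hb).1 h'
  exact ⟨h₁, h₃, h₂, h₄⟩

/-- A causal segment meets the line through two points between which it runs and which separates
its endpoints. -/
theorem exists_crossing {a₁ a₂ a₃ a₄ : LorentzModel K} (h₁₂ : a₁.Causal a₂) (h₂₃ : a₂.Causal a₃)
    (h₃₄ : a₃.Causal a₄) (hD : a₁.tau a₄ < finiteDiameter K) (hpos : 0 < a₁.tau a₄)
    (ho : OppositeSides a₁ a₄ a₂ a₃) :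
    ∃ r, a₂.Causal r ∧ r.Causal a₃ ∧ side a₁ a₄ r = 0 ∧ a₁.tau r + r.tau a₄ = a₁.tau a₄ ∧
      a₂.tau r + r.tau a₃ = a₂.tau a₃ ∧
      (0 < a₂.tau a₃ → (r = a₂ ∨ 0 < a₂.tau r) ∧ (r = a₃ ∨ 0 < r.tau a₃)) := by
  have h₁₃ := causal_trans h₁₂ h₂₃
  have h₂₄ := causal_trans h₂₃ h₃₄
  obtain ⟨c, p₁, p₄, c₁, c₄, hG, hch⟩ := exists_chart (causal_trans h₁₃ h₃₄) hD
  obtain ⟨p₂, c₂⟩ := hch a₂ h₁₂ h₂₄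
  obtain ⟨p₃, c₃⟩ := hch a₃ h₁₃ h₃₄
  obtain ⟨m, hm, hside⟩ := c₁.side_mul_side c₄ c₂ c₁ c₄ c₃
  rw [OppositeSides, hside] at ho
  have ho' := nonpos_of_mul_nonpos_right ho hm
  have b₂ := c₁.between c₄ c₂ h₁₂ h₂₄
  have b₃ := c₁.between c₄ c₃ h₁₃ h₃₄
  obtain ⟨g₁, g₂⟩ := (c₂.causal_iff c₃).1 h₂₃
  have hG' := hG.sub b₂ b₃ g₁ g₂
  -- The determinant against `p₁, p₄` is linear in homogeneous coordinates and has opposite signs at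
  -- `p₂` and `p₃`, so coefficients inversely proportional to its absolute values there cancel it.
  obtain ⟨z, hz, α, β, hα, hβ, hcomb, hzero⟩ : ∃ z, Between p₂ p₃ z ∧ ∃ α β, 0 ≤ α ∧ 0 ≤ β ∧
      IsComb (ep K) α β p₂ p₃ z ∧ det3 (ep K) p₁ p₄ z = 0 := by
    obtain ⟨z, hz, α, β, hα, hβ, -, hr, hcomb⟩ :=
      hG'.exists_ratio (abs_nonneg (det3 (ep K) p₁ p₄ p₃)) (abs_nonneg (det3 (ep K) p₁ p₄ p₂))
    by_cases h0 : det3 (ep K) p₁ p₄ p₂ = 0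
    · refine ⟨p₂, hG'.between_left, 1, 0, zero_le_one, le_rfl, ?_, h0⟩
      constructor <;> ring
    refine ⟨z, hz, α, β, hα, hβ, hcomb, ?_⟩
    rw [hcomb.det3_eq]
    rcases lt_or_gt_of_ne h0 with h | h
    · rw [abs_of_neg h, abs_of_nonneg (by nlinarith)] at hr
      linarith
    · rw [abs_of_pos h, abs_of_nonpos (by nlinarith)] at hr
      linarith
  have hz' : Between p₁ p₄ z := ⟨b₂.fst_left.trans hz.fst_left, hz.fst_right.trans b₃.fst_right,
    b₂.snd_left.trans hz.snd_left, hz.snd_right.trans b₃.snd_right⟩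
  obtain ⟨r, cr⟩ := exists_isChart K c (hG.wt_pos hz')
  obtain ⟨l₁, l₂⟩ := (c₁.tau_pos_iff c₄ hG).1 hpos
  obtain ⟨α', β', hα', hβ', hcomb', -, -⟩ := hG.exists_isComb l₁ l₂ hz' hzero
  refine ⟨r, (c₂.causal_iff cr).2 ⟨hz.fst_left, hz.snd_left⟩,
    (cr.causal_iff c₃).2 ⟨hz.fst_right, hz.snd_right⟩, (c₁.det3_eq_zero_iff c₄ cr).2 hzero,
    c₁.tau_add hcomb' hα' hβ' hG hz' cr c₄, c₂.tau_add hcomb hα hβ hG' hz cr c₃, fun hp => ?_⟩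
  obtain ⟨l₁, l₂⟩ := (c₂.tau_pos_iff c₃ hG').1 hp
  obtain ⟨_, _, _, _, _, k₁, k₂⟩ := hG'.exists_isComb l₁ l₂ hz hcomb.det3_eq_zero
  refine ⟨k₁.imp (fun e => ?_) fun e => ?_, k₂.imp (fun e => ?_) fun e => ?_⟩
  · exact IsChart.ext (e ▸ cr) c₂
  · exact (c₂.tau_pos_iff cr (hG'.sub hG'.between_left hz hz.fst_left hz.snd_left)).2 e
  · exact IsChart.ext (e ▸ cr) c₃
  · exact (cr.tau_pos_iff c₃ (hG'.sub hz hG'.between_right hz.fst_right hz.snd_right)).2 e.2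

/-- Time reversal of the model space. -/
def rev (a : LorentzModel K) : LorentzModel K where
  t := -a.t
  x := a.x
  t_lt h := by rw [abs_neg]; exact a.t_lt h
  x_lt := a.x_lt

theorem rev_rev (a : LorentzModel K) : rev (rev a) = a := by
  ext <;> simp [rev]

theorem causal_rev : (rev b).Causal (rev a) ↔ a.Causal b := by
  unfold LorentzModel.Causal rev
  rw [abs_sub_comm]
  ring_nf

theorem tau_rev (a b : LorentzModel K) : (rev b).tau (rev a) = a.tau b := by
  unfold LorentzModel.tau
  have h₁ : (rev a).t - (rev b).t = b.t - a.t := by simp only [rev]; ring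
  have h₂ : (rev a).x - (rev b).x = -(b.x - a.x) := by simp only [rev]; ring
  have h₃ : (rev b).x + (rev a).x = a.x + b.x := by simp only [rev]; ring
  have h₄ : Real.sin (rev b).t * Real.sin (rev a).t = Real.sin a.t * Real.sin b.t := by
    simp only [rev, Real.sin_neg]; ring
  have h₅ : Real.cos (rev b).t * Real.cos (rev a).t = Real.cos a.t * Real.cos b.t := by
    simp only [rev, Real.cos_neg]; ring
  have h₆ : Real.sin (rev b).x * Real.sin (rev a).x = Real.sin a.x * Real.sin b.x := by
    simp only [rev]; ring
  have h₇ : Real.cos (rev b).x * Real.cos (rev a).x = Real.cos a.x * Real.cos b.x := by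
    simp only [rev]; ring
  rw [h₁, h₂, h₃, h₄, h₅, h₆, h₇, neg_sq, Real.cos_neg]
  by_cases h : a.Causal b
  · rw [if_pos h, if_pos (causal_rev.2 h)]
  · rw [if_neg h, if_neg (mt causal_rev.1 h)]

/-- Time reversal changes the sign of the determinant, and so does exchanging the first two points.
-/
theorem side_rev (a b d : LorentzModel K) : side (rev b) (rev a) (rev d) = side a b d := by
  unfold side ambient
  rw [Matrix.det_fin_three, Matrix.det_fin_three]
  split_ifs <;> simp only [Matrix.of_apply, Matrix.cons_val, rev, Real.sin_neg, Real.cos_neg] <;>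
    ring

/-- A segment can be continued from one of its points towards its future endpoint. -/
theorem exists_later {a r b : LorentzModel K} (har : a.Causal r) (hrb : r.Causal b)
    (hs : side a b r = 0) (hpos : 0 < a.tau b) (hD : a.tau b < finiteDiameter K) {s t : ℝ}
    (hst : s < t) (ht : t ≤ 1) (hs₀ : 0 ≤ s) (hr : a.tau r = ENNReal.ofReal s * a.tau b) :
    ∃ r' : LorentzModel K, a.Causal r' ∧ r'.Causal b ∧ 0 < r.tau r' ∧
      a.tau r' = ENNReal.ofReal t * a.tau b ∧ r'.tau b = ENNReal.ofReal (1 - t) * a.tau b := by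
  obtain ⟨c, p, q, ca, cb, hG, hch⟩ := exists_chart (causal_trans har hrb) hD
  obtain ⟨z, cr⟩ := hch r har hrb
  have hz := ca.between cb cr har hrb
  obtain ⟨l₁, l₂⟩ := (ca.tau_pos_iff cb hG).1 hpos
  obtain ⟨α, β, hα, hβ, hcomb, -, -⟩ :=
    hG.exists_isComb l₁ l₂ hz ((ca.det3_eq_zero_iff cb cr).1 hs)
  obtain ⟨θ₁, θ₂, hθ₁, hθ₂, hθ, e₁, e₂, e⟩ := hcomb.exists_add hα hβ hG hz
  have hG₁ := hG.sub hG.between_left hz hz.fst_left hz.snd_left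
  have hG₂ := hG.sub hz hG.between_right hz.fst_right hz.snd_right
  have hτ := ca.tau_eq_ofReal cb hG hθ e
  have hτ₁ := ca.tau_eq_ofReal cr hG₁ hθ₁ e₁
  have hθpos : 0 < θ₁ + θ₂ := by
    rw [hτ, ENNReal.ofReal_pos] at hpos
    linarith
  rw [hτ, hτ₁, ← ENNReal.ofReal_mul hs₀, ENNReal.ofReal_eq_ofReal_iff (by linarith [hθ₁.1])
    (by positivity)] at hr
  -- This is the half-length from `r` to the wanted point. It does not exceed `θ₂`, because `θ₁ = s
  -- * (θ₁ + θ₂)` and `t ≤ 1`.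
  have hφ₀ : 0 < (t - s) * (θ₁ + θ₂) := mul_pos (sub_pos.2 hst) hθpos
  have hφ₁ : (t - s) * (θ₁ + θ₂) ≤ θ₂ := by nlinarith
  have hφ : InRange K ((t - s) * (θ₁ + θ₂)) := hθ₂.mono hφ₀.le hφ₁
  obtain ⟨z', hz', eS, α', β', hα', hβ', hcomb'⟩ :=
    hG₂.exists_chord_eq (sq_nonneg (sn K ((t - s) * (θ₁ + θ₂))))
      (by rw [← e₂]; exact (hφ.sn_sq_le_iff hθ₂).2 hφ₁)
  have hz'' : Between p q z' := ⟨hz.fst_left.trans hz'.fst_left, hz'.fst_right,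
    hz.snd_left.trans hz'.snd_left, hz'.snd_right⟩
  obtain ⟨r', cr'⟩ := exists_isChart K c (hG.wt_pos hz'')
  -- Composing the two combinations puts `z'` on the whole segment as well, so lengths also add at
  -- `z'` between `p` and `q`.
  have hcomb'' : IsComb (ep K) (α' * α) (α' * β + β') p q z' := by
    constructor
    · rw [hcomb'.co, hcomb.co]
      ring
    · rw [hcomb'.fst, hcomb.fst]
      ring
    · rw [hcomb'.snd, hcomb.snd]
      ring
  have hG₃ := hG.sub hz hz'' hz'.fst_left hz'.snd_left
  have hG₄ := hG.sub hz'' hG.between_right hz'.fst_right hz'.snd_right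
  have hG₅ := hG.sub hG.between_left hz'' hz''.fst_left hz''.snd_left
  obtain ⟨φ₁, φ₂, hφ₁', hφ₂', hφs, g₁, g₂, g⟩ := hcomb'.exists_add hα' hβ' hG₂ hz'
  obtain ⟨ψ₁, ψ₂, hψ₁, hψ₂, hψs, j₁, j₂, j⟩ :=
    hcomb''.exists_add (by positivity) (by positivity) hG hz''
  have i₁ := hφ.sn_sq_inj hφ₁' (eS.symm.trans g₁.symm)
  have i₂ := hθ₂.sn_sq_inj hφs (e₂.trans g.symm)
  have i₃ := hψ₂.sn_sq_inj hφ₂' (j₂.trans g₂.symm)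
  have i₄ := hθ.sn_sq_inj hψs (e.trans j.symm)
  refine ⟨r', (ca.causal_iff cr').2 ⟨hz''.fst_left, hz''.snd_left⟩,
    (cr'.causal_iff cb).2 ⟨hz''.fst_right, hz''.snd_right⟩, ?_, ?_, ?_⟩
  · rw [cr.tau_eq_ofReal cr' hG₃ hφ eS.symm, ENNReal.ofReal_pos]
    linarith
  · rw [ca.tau_eq_ofReal cr' hG₅ hψ₁ j₁, hτ, ← ENNReal.ofReal_mul (by linarith)]
    congr 1
    linarith
  · rw [cr'.tau_eq_ofReal cb hG₄ hψ₂ j₂, hτ, ← ENNReal.ofReal_mul (by linarith)]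
    congr 1
    linarith

/-- A segment can be continued from one of its points towards its past endpoint. -/
theorem exists_earlier {a r b : LorentzModel K} (har : a.Causal r) (hrb : r.Causal b)
    (hs : side a b r = 0) (hpos : 0 < a.tau b) (hD : a.tau b < finiteDiameter K) {s t : ℝ}
    (hst : t < s) (ht : 0 ≤ t) (hs₁ : s ≤ 1)
    (hr : r.tau b = ENNReal.ofReal (1 - s) * a.tau b) :
    ∃ r' : LorentzModel K, a.Causal r' ∧ r'.Causal b ∧ 0 < r'.tau r ∧
      a.tau r' = ENNReal.ofReal t * a.tau b ∧ r'.tau b = ENNReal.ofReal (1 - t) * a.tau b := by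
  obtain ⟨r', h₁, h₂, h₃, h₄, h₅⟩ := exists_later (causal_rev.2 hrb) (causal_rev.2 har)
    ((side_rev a b r).trans hs) ((tau_rev a b).symm ▸ hpos) ((tau_rev a b).symm ▸ hD)
    (s := 1 - s) (t := 1 - t) (by linarith) (by linarith) (by linarith)
    (by rw [tau_rev, tau_rev, hr])
  rw [← rev_rev r', causal_rev] at h₁ h₂
  rw [← rev_rev r', tau_rev] at h₃ h₄ h₅
  rw [tau_rev] at h₄ h₅
  rw [sub_sub_cancel] at h₅
  exact ⟨rev r', h₂, h₁, h₃, h₅, h₄⟩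

end NullChart

/-! ### Intersecting diagonals and hinge monotonicity in the model spaces -/

namespace NullChart

open LorentzModel

section Crossing

variable {ε : ℝ} {p₁ p₂ p₃ p₄ : ℝ × ℝ}

/-- A linear functional on homogeneous coordinates that vanishes on a null line through `c`. -/
def nullFst (ε : ℝ) (c x : ℝ × ℝ) : ℝ := (x.1 - c.1) * (1 + ε * c.1 * x.2)

/-- A linear functional on homogeneous coordinates that vanishes on the other null line
through `c`. -/
def nullSnd (ε : ℝ) (c x : ℝ × ℝ) : ℝ := (x.2 - c.2) * (1 + ε * x.1 * c.2)

/-- Cramer's linear relation between four vectors of a three-dimensional space, evaluated under a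
linear functional. -/
theorem nullFst_relation (ε : ℝ) (c p₁ p₂ p₃ p₄ : ℝ × ℝ) :
    nullFst ε c p₁ * det3 ε p₂ p₃ p₄ - nullFst ε c p₂ * det3 ε p₁ p₃ p₄ +
      nullFst ε c p₃ * det3 ε p₁ p₂ p₄ - nullFst ε c p₄ * det3 ε p₁ p₂ p₃ = 0 := by
  simp only [nullFst, det3, co]
  ring

theorem nullSnd_relation (ε : ℝ) (c p₁ p₂ p₃ p₄ : ℝ × ℝ) :
    nullSnd ε c p₁ * det3 ε p₂ p₃ p₄ - nullSnd ε c p₂ * det3 ε p₁ p₃ p₄ +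
      nullSnd ε c p₃ * det3 ε p₁ p₂ p₄ - nullSnd ε c p₄ * det3 ε p₁ p₂ p₃ = 0 := by
  simp only [nullSnd, det3, co]
  ring

/-- Expanded, the functional is `x.1 - c.1 * co ε x - ε * c.1 ^ 2 * x.2`, which is linear in the
homogeneous coordinates of `x`. -/
theorem IsComb.nullFst_eq {α β : ℝ} {p q r : ℝ × ℝ} (h : IsComb ε α β p q r) (c : ℝ × ℝ) :
    nullFst ε c r = α * nullFst ε c p + β * nullFst ε c q := by
  have h₁ := h.co
  simp only [NullChart.co] at h₁
  simp only [nullFst]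
  linear_combination h.fst - c.1 * h₁ - ε * c.1 ^ 2 * h.snd

theorem IsComb.nullSnd_eq {α β : ℝ} {p q r : ℝ × ℝ} (h : IsComb ε α β p q r) (c : ℝ × ℝ) :
    nullSnd ε c r = α * nullSnd ε c p + β * nullSnd ε c q := by
  have h₁ := h.co
  simp only [NullChart.co] at h₁
  simp only [nullSnd]
  linear_combination h.snd - c.2 * h₁ - ε * c.2 ^ 2 * h.fst

theorem nullFst_self (ε : ℝ) (c : ℝ × ℝ) : nullFst ε c c = 0 := by simp [nullFst]

theorem nullSnd_self (ε : ℝ) (c : ℝ × ℝ) : nullSnd ε c c = 0 := by simp [nullSnd]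

/-- The diagonals of a causal quadrilateral whose outer vertices lie on the same side of its
middle edge intersect. -/
theorem Good.exists_diagonal (h : Good ε p₁ p₄) (h₂ : Between p₁ p₄ p₂) (h₃ : Between p₂ p₄ p₃)
    (hlt : p₂.1 < p₃.1 ∧ p₂.2 < p₃.2) (hs : 0 ≤ det3 ε p₂ p₃ p₁ * det3 ε p₂ p₃ p₄) :
    ∃ z, Between p₂ p₃ z ∧ det3 ε p₁ p₃ z = 0 ∧ det3 ε p₂ p₄ z = 0 := by
  have h₃' : Between p₁ p₄ p₃ := ⟨h₂.fst_left.trans h₃.fst_left, h₃.fst_right,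
    h₂.snd_left.trans h₃.snd_left, h₃.snd_right⟩
  have e₁ : det3 ε p₂ p₃ p₁ = det3 ε p₁ p₂ p₃ := by simp only [det3]; ring
  have e₂ : det3 ε p₁ p₃ p₂ = -det3 ε p₁ p₂ p₃ := by simp only [det3]; ring
  rw [e₁] at hs
  by_cases h0 : det3 ε p₁ p₂ p₃ = 0 ∧ det3 ε p₁ p₃ p₄ = 0
  · exact ⟨p₂, ⟨le_rfl, hlt.1.le, le_rfl, hlt.2.le⟩, by rw [e₂, h0.1, neg_zero],
      det3_self_left _ _ _⟩
  -- A common sign `σ` treats both orientations of the quadrilateral at once.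
  obtain ⟨σ, hσ₁, hσ₂, hσ₃⟩ : ∃ σ : ℝ, σ ≠ 0 ∧ 0 ≤ σ * det3 ε p₁ p₂ p₃ ∧
      0 ≤ σ * det3 ε p₂ p₃ p₄ := by
    rcases mul_nonneg_iff.1 hs with h | h
    · exact ⟨1, one_ne_zero, by linarith, by linarith⟩
    · exact ⟨-1, by norm_num, by linarith, by linarith⟩
  have w : ∀ {x y : ℝ × ℝ}, Between p₁ p₄ x → Between p₁ p₄ y → 0 < 1 + ε * x.1 * y.2 :=
    fun hx hy => h.pos hx.fst_left hx.fst_right hy.snd_left hy.snd_right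
  have hp₁ := h.between_left
  have hp₄ := h.between_right
  have i₁ : nullFst ε p₃ p₁ ≤ 0 :=
    mul_nonpos_of_nonpos_of_nonneg (sub_nonpos.2 h₃'.fst_left) (w h₃' hp₁).le
  have i₂ : nullFst ε p₃ p₂ < 0 := mul_neg_of_neg_of_pos (sub_neg.2 hlt.1) (w h₃' h₂)
  have i₄ : 0 ≤ nullFst ε p₃ p₄ := mul_nonneg (sub_nonneg.2 h₃'.fst_right) (w h₃' hp₄).le
  have j₁ : nullSnd ε p₃ p₁ ≤ 0 :=
    mul_nonpos_of_nonpos_of_nonneg (sub_nonpos.2 h₃'.snd_left) (w hp₁ h₃').le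
  have r₁ := nullFst_relation ε p₃ p₁ p₂ p₃ p₄
  have r₂ := nullSnd_relation ε p₃ p₁ p₂ p₃ p₄
  rw [nullFst_self, zero_mul, add_zero] at r₁
  rw [nullSnd_self, zero_mul, add_zero] at r₂
  -- The null functional at `p₃` is negative at `p₂`, nonpositive at `p₁` and nonnegative at `p₄`,
  -- so Cramer's relation fixes the sign of this determinant. Hence the line through `p₁` and `p₃`
  -- separates `p₂` from `p₄` and meets the segment between them.
  have hD₂ : 0 ≤ σ * det3 ε p₁ p₃ p₄ := by
    have : -nullFst ε p₃ p₂ * (σ * det3 ε p₁ p₃ p₄) = -nullFst ε p₃ p₁ * (σ * det3 ε p₂ p₃ p₄) +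
        nullFst ε p₃ p₄ * (σ * det3 ε p₁ p₂ p₃) := by linear_combination σ * r₁
    refine nonneg_of_mul_nonneg_right (a := -nullFst ε p₃ p₂) ?_ (by linarith)
    rw [this]
    exact add_nonneg (mul_nonneg (by linarith) hσ₃) (mul_nonneg i₄ hσ₂)
  have hG := h.sub h₂ hp₄ h₂.fst_right h₂.snd_right
  obtain ⟨z, hz, α, β, hα, hβ, hαβ, hr, hcomb⟩ := hG.exists_ratio hD₂ hσ₂
  have hz' : Between p₁ p₄ z := ⟨h₂.fst_left.trans hz.fst_left, hz.fst_right,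
    h₂.snd_left.trans hz.snd_left, hz.snd_right⟩
  have hlm : 0 < σ * det3 ε p₁ p₃ p₄ + σ * det3 ε p₁ p₂ p₃ := by
    refine lt_of_le_of_ne (add_nonneg hD₂ hσ₂) fun e => h0 ⟨?_, ?_⟩
    · exact (mul_eq_zero.1 (by linarith)).resolve_left hσ₁
    · exact (mul_eq_zero.1 (by linarith)).resolve_left hσ₁
  refine ⟨z, ⟨hz.fst_left, ?_, hz.snd_left, ?_⟩, ?_, hcomb.det3_eq_zero⟩
  -- That `z` does not pass beyond `p₃`: by Cramer's relation the functional at `z` is, up to a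
  -- positive factor, a nonnegative multiple of its value at `p₁`.
  · have e := hcomb.nullFst_eq p₃
    have : (σ * det3 ε p₁ p₃ p₄ + σ * det3 ε p₁ p₂ p₃) * nullFst ε p₃ z =
        (α + β) * ((σ * det3 ε p₂ p₃ p₄) * nullFst ε p₃ p₁) := by
      linear_combination (σ * det3 ε p₁ p₃ p₄ + σ * det3 ε p₁ p₂ p₃) * e +
        (nullFst ε p₃ p₂ - nullFst ε p₃ p₄) * hr - (α + β) * σ * r₁
    have : nullFst ε p₃ z ≤ 0 := by
      refine nonpos_of_mul_nonpos_right (a := σ * det3 ε p₁ p₃ p₄ + σ * det3 ε p₁ p₂ p₃) ?_ hlm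
      rw [this]
      exact mul_nonpos_of_nonneg_of_nonpos hαβ.le (mul_nonpos_of_nonneg_of_nonpos hσ₃ i₁)
    rw [nullFst] at this
    linarith [nonpos_of_mul_nonpos_left this (w h₃' hz')]
  · have e := hcomb.nullSnd_eq p₃
    have : (σ * det3 ε p₁ p₃ p₄ + σ * det3 ε p₁ p₂ p₃) * nullSnd ε p₃ z =
        (α + β) * ((σ * det3 ε p₂ p₃ p₄) * nullSnd ε p₃ p₁) := by
      linear_combination (σ * det3 ε p₁ p₃ p₄ + σ * det3 ε p₁ p₂ p₃) * e +
        (nullSnd ε p₃ p₂ - nullSnd ε p₃ p₄) * hr - (α + β) * σ * r₂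
    have : nullSnd ε p₃ z ≤ 0 := by
      refine nonpos_of_mul_nonpos_right (a := σ * det3 ε p₁ p₃ p₄ + σ * det3 ε p₁ p₂ p₃) ?_ hlm
      rw [this]
      exact mul_nonpos_of_nonneg_of_nonpos hαβ.le (mul_nonpos_of_nonneg_of_nonpos hσ₃ j₁)
    rw [nullSnd] at this
    linarith [nonpos_of_mul_nonpos_left this (w hz' h₃')]
  · rw [hcomb.det3_eq, e₂]
    have : σ * (α * -det3 ε p₁ p₂ p₃ + β * det3 ε p₁ p₃ p₄) = 0 := by linear_combination -hr
    exact (mul_eq_zero.1 this).resolve_left hσ₁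

end Crossing

variable {K : ℝ}

/-- The diagonals of a causal quadrilateral in the model space whose outer vertices lie on the same
side of the line through its middle edge intersect. -/
theorem exists_diagonal_crossing {a₁ a₂ a₃ a₄ : LorentzModel K} (h₁₂ : a₁.Causal a₂)
    (h₂₃ : a₂.Causal a₃) (h₃₄ : a₃.Causal a₄) (hpos : 0 < a₂.tau a₃)
    (hD : a₁.tau a₄ < finiteDiameter K) (hs : SameSide a₂ a₃ a₁ a₄) :
    ∃ r, a₂.Causal r ∧ r.Causal a₃ ∧ side a₁ a₃ r = 0 ∧ side a₂ a₄ r = 0 ∧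
      a₁.tau r + r.tau a₃ = a₁.tau a₃ ∧ a₂.tau r + r.tau a₄ = a₂.tau a₄ ∧
      (r = a₂ ∨ 0 < a₂.tau r) ∧ (r = a₃ ∨ 0 < r.tau a₃) := by
  have h₁₃ := causal_trans h₁₂ h₂₃
  have h₂₄ := causal_trans h₂₃ h₃₄
  obtain ⟨c, p₁, p₄, c₁, c₄, hG, hch⟩ := exists_chart (causal_trans h₁₃ h₃₄) hD
  obtain ⟨p₂, c₂⟩ := hch a₂ h₁₂ h₂₄
  obtain ⟨p₃, c₃⟩ := hch a₃ h₁₃ h₃₄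
  obtain ⟨m, hm, hside⟩ := c₂.side_mul_side c₃ c₁ c₂ c₃ c₄
  rw [SameSide, hside] at hs
  have hs' := nonneg_of_mul_nonneg_right hs hm
  have b₂ := c₁.between c₄ c₂ h₁₂ h₂₄
  have b₃ := c₁.between c₄ c₃ h₁₃ h₃₄
  obtain ⟨g₁, g₂⟩ := (c₂.causal_iff c₃).1 h₂₃
  have hG₂₃ := hG.sub b₂ b₃ g₁ g₂
  have hG₁₃ := hG.sub hG.between_left b₃ b₃.fst_left b₃.snd_left
  have hG₂₄ := hG.sub b₂ hG.between_right b₂.fst_right b₂.snd_right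
  have hlt := (c₂.tau_pos_iff c₃ hG₂₃).1 hpos
  obtain ⟨z, hz, d₁, d₂⟩ := hG.exists_diagonal b₂ (c₂.between c₄ c₃ h₂₃ h₃₄) hlt hs'
  have hz₁₃ : Between p₁ p₃ z := ⟨b₂.fst_left.trans hz.fst_left, hz.fst_right,
    b₂.snd_left.trans hz.snd_left, hz.snd_right⟩
  have hz₂₄ : Between p₂ p₄ z := ⟨hz.fst_left, hz.fst_right.trans b₃.fst_right, hz.snd_left,
    hz.snd_right.trans b₃.snd_right⟩
  obtain ⟨r, cr⟩ := exists_isChart K c (hG₂₃.wt_pos hz)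
  obtain ⟨α, β, hα, hβ, hcomb, -, k₂⟩ := hG₁₃.exists_isComb (b₂.fst_left.trans_lt hlt.1)
    (b₂.snd_left.trans_lt hlt.2) hz₁₃ d₁
  obtain ⟨α', β', hα', hβ', hcomb', k₁, -⟩ := hG₂₄.exists_isComb (hlt.1.trans_le b₃.fst_right)
    (hlt.2.trans_le b₃.snd_right) hz₂₄ d₂
  refine ⟨r, (c₂.causal_iff cr).2 ⟨hz.fst_left, hz.snd_left⟩,
    (cr.causal_iff c₃).2 ⟨hz.fst_right, hz.snd_right⟩, (c₁.det3_eq_zero_iff c₃ cr).2 d₁,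
    (c₂.det3_eq_zero_iff c₄ cr).2 d₂, c₁.tau_add hcomb hα hβ hG₁₃ hz₁₃ cr c₃,
    c₂.tau_add hcomb' hα' hβ' hG₂₄ hz₂₄ cr c₄, k₁.imp (fun e => ?_) fun e => ?_,
    k₂.imp (fun e => ?_) fun e => ?_⟩
  · exact IsChart.ext (e ▸ cr) c₂
  · exact (c₂.tau_pos_iff cr (hG₂₃.sub hG₂₃.between_left hz hz.fst_left hz.snd_left)).2 e
  · exact IsChart.ext (e ▸ cr) c₃
  · exact (cr.tau_pos_iff c₃ (hG₂₃.sub hz hG₂₃.between_right hz.fst_right hz.snd_right)).2 e.2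

/-- The coefficients in Stewart's theorem are determined by the chords along the segment. -/
theorem stewart_unique {ε S S₁ S₂ k l m k' l' m' : ℝ} (hS : 0 < S) (hS' : 0 < 1 - ε * S)
    (e : 2 * ε * k = 1 - l - m) (e₁ : S₁ = k + m * S) (e₂ : S₂ = k + l * S)
    (e' : 2 * ε * k' = 1 - l' - m') (e₁' : S₁ = k' + m' * S) (e₂' : S₂ = k' + l' * S) :
    k = k' ∧ l = l' ∧ m = m' := by
  have hk : k = k' := by
    have : 2 * (1 - ε * S) * (k - k') = 0 := by
      linear_combination -S * e - e₁ - e₂ + S * e' + e₁' + e₂'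
    have := (mul_eq_zero.1 this).resolve_left (by positivity)
    linarith
  refine ⟨hk, ?_, ?_⟩
  · have : S * (l - l') = 0 := by linear_combination e₂' - e₂ - hk
    have := (mul_eq_zero.1 this).resolve_left hS.ne'
    linarith
  · have : S * (m - m') = 0 := by linear_combination e₁' - e₁ - hk
    have := (mul_eq_zero.1 this).resolve_left hS.ne'
    linarith

/-- A triangle with one vertex at the origin and one side on the diagonal, with prescribed
half-lengths. -/
theorem exists_good_triangle {A B φ : ℝ} (hφ : InRange K φ) (hA : 0 < A) (hB : 0 ≤ B)
    (h : A + B ≤ φ) : ∃ w : ℝ × ℝ, 0 ≤ w.1 ∧ 0 ≤ w.2 ∧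
      Good (ep K) (-(sn K A / cs K A), -(sn K A / cs K A)) w ∧
      chord (ep K) (0, 0) w = sn K B ^ 2 ∧
      chord (ep K) (-(sn K A / cs K A), -(sn K A / cs K A)) w = sn K φ ^ 2 := by
  have hA' : InRange K A := hφ.mono hA.le (by linarith)
  have hB' : InRange K B := hφ.mono hB (by linarith)
  have hAB : InRange K (A + B) := hφ.mono (by linarith) h
  have cA := hA'.cs_pos
  have cB := hB'.cs_pos
  have cAB := hAB.cs_pos
  have qA := cs_sq K A
  have qB := cs_sq K B
  have sA : 0 < sn K A := by
    have := hA'.sn_sq_pos_iff.2 hA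
    exact lt_of_le_of_ne hA'.sn_nonneg fun e => by rw [← e] at this; norm_num at this
  have sB := hB'.sn_nonneg
  have hS := (hAB.sn_sq_le_iff hφ).2 h
  have hS' := hφ.sn_sq_lt
  rw [sn_add] at hS
  rw [cs_add] at cAB
  set S := sn K φ ^ 2
  set e := ep K
  obtain ⟨k, hk⟩ : ∃ k, k = sn K A / cs K A := ⟨_, rfl⟩
  obtain ⟨m, hm⟩ : ∃ m, m = sn K B / cs K B := ⟨_, rfl⟩
  have hk₀ : 0 < k := hk ▸ div_pos sA cA
  have hm₀ : 0 ≤ m := hm ▸ div_nonneg sB cB.le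
  have hsA : sn K A = k * cs K A := by rw [hk, div_mul_cancel₀ _ cA.ne']
  have hsB : sn K B = m * cs K B := by rw [hm, div_mul_cancel₀ _ cB.ne']
  rw [← hk]
  rw [hsA] at qA hS cAB
  rw [hsB] at qB hS cAB
  generalize cs K A = x at *
  generalize cs K B = y at *
  have hx : x ^ 2 * (1 + e * k ^ 2) = 1 := by linear_combination qA
  have hy : y ^ 2 * (1 + e * m ^ 2) = 1 := by linear_combination qB
  have hX : 0 < 1 + e * k ^ 2 := pos_of_mul_pos_right (hx.symm ▸ one_pos) (sq_nonneg x)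
  have hY : 0 < 1 + e * m ^ 2 := pos_of_mul_pos_right (hy.symm ▸ one_pos) (sq_nonneg y)
  have hkm : 0 < 1 - e * (k * m) := by
    refine pos_of_mul_pos_right (a := x * y) ?_ (by positivity)
    linear_combination cAB
  have hge : (k + m) ^ 2 ≤ S * ((1 + e * k ^ 2) * (1 + e * m ^ 2)) := by
    have := mul_le_mul_of_nonneg_right hS (mul_pos hX hY).le
    refine le_trans (le_of_eq ?_) this
    linear_combination (-(k + m) ^ 2 * y ^ 2 * (1 + e * m ^ 2)) * hx - (k + m) ^ 2 * hy
  -- For a third vertex `(u, v)`, the chord to the origin prescribes `u * v = m ^ 2`, and the chord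
  -- to `(-k, -k)` then prescribes `u + v = L`. The bound `A + B ≤ φ` becomes `2 * m ≤ L`, which
  -- makes the roots of this quadratic real and nonnegative.
  obtain ⟨L, hL⟩ : ∃ L, k * L = S * ((1 + e * k ^ 2) * (1 + e * m ^ 2)) - m ^ 2 - k ^ 2 :=
    ⟨_, mul_div_cancel₀ _ hk₀.ne'⟩
  have hL₂ : 2 * m ≤ L := by
    refine le_of_mul_le_mul_left ?_ hk₀
    rw [hL]
    linarith
  obtain ⟨u, v, hu, hv, huv, hs⟩ : ∃ u v : ℝ, 0 ≤ u ∧ 0 ≤ v ∧ u * v = m ^ 2 ∧ u + v = L := by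
    have hd : 0 ≤ L ^ 2 - 4 * m ^ 2 := by nlinarith
    have hd' : √(L ^ 2 - 4 * m ^ 2) ≤ L := by
      rw [Real.sqrt_le_left (by linarith)]
      nlinarith
    have hd'' := Real.sq_sqrt hd
    have := Real.sqrt_nonneg (L ^ 2 - 4 * m ^ 2)
    refine ⟨(L + √(L ^ 2 - 4 * m ^ 2)) / 2, (L - √(L ^ 2 - 4 * m ^ 2)) / 2, by linarith,
      by linarith, ?_, by ring⟩
    linear_combination -hd'' / 4
  have hprod : 0 < (1 - e * k * u) * (1 - e * k * v) := by
    have : (1 - e * k * u) * (1 - e * k * v) =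
        (1 + e * k ^ 2) * (1 + e * m ^ 2) * (1 - e * S) := by
      linear_combination e ^ 2 * k ^ 2 * huv - e * k * hs - e * hL
    rw [this]
    positivity
  -- If both factors were negative, `e * k * u` and `e * k * v` would exceed `1`, but their product
  -- is `(e * (k * m)) ^ 2`, which is less than `1` because the generalised cosine of `A + B` is
  -- positive.
  have hcorner : 0 < 1 - e * k * u ∧ 0 < 1 - e * k * v := by
    rcases pos_and_pos_or_neg_and_neg_of_mul_pos hprod with h | ⟨h₁, h₂⟩
    · exact h
    · exfalso
      have he : 0 < e := by
        by_contra he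
        nlinarith [mul_nonneg hk₀.le hu]
      have : (e * (k * m)) ^ 2 < 1 := by
        rw [sq_lt_one_iff₀ (by positivity)]
        linarith
      have : 1 < (e * k * u) * (e * k * v) := one_lt_mul_of_lt_of_le (by linarith) (by linarith)
      have : (e * k * u) * (e * k * v) = (e * (k * m)) ^ 2 := by
        linear_combination e ^ 2 * k ^ 2 * huv
      linarith
  have hw : wt e (-k, -k) = 1 + e * k ^ 2 := by simp only [wt]; ring
  have hw' : wt e (u, v) = 1 + e * m ^ 2 := by
    simp only [wt]
    linear_combination e * huv
  refine ⟨(u, v), hu, hv, ⟨by dsimp only; linarith, by dsimp only; linarith, ?_, ?_, ?_, ?_⟩,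
    ?_, ?_⟩
  · exact hX.trans_eq hw.symm
  · exact hY.trans_eq hw'.symm
  · dsimp only
    linarith [hcorner.2]
  · dsimp only
    linarith [hcorner.1]
  · rw [chord, hw', show wt e (0, 0) = 1 by simp [wt], hsB, div_eq_iff (by positivity)]
    dsimp only
    linear_combination huv - m ^ 2 * hy
  · rw [chord, hw, hw', div_eq_iff (by positivity)]
    dsimp only
    linear_combination huv + k * hs + hL

/-- Given a triangle `a₁ ≪ a₃ ≤ a₄` with a point `r` on the side from `a₁` to `a₃`, there is a
triangle with a longer side from the first to the third vertex and the other two sides unchanged,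
and in it the time separation from the corresponding point to the third vertex is larger. -/
theorem exists_longer_triangle {a₁ r a₃ a₄ : LorentzModel K} (h₁ : a₁.Causal r)
    (h₃ : r.Causal a₃) (h₃₄ : a₃.Causal a₄) (hs : side a₁ a₃ r = 0) (hpos : 0 < a₁.tau a₃)
    (hr : 0 < r.tau a₃) {T : ENNReal} (hT : T < finiteDiameter K) (hlt : a₁.tau a₄ < T)
    (hge : a₁.tau a₃ + a₃.tau a₄ ≤ T) :
    ∃ b₁ b₂ b₃ b₄ : LorentzModel K, b₁.Causal b₂ ∧ b₂.Causal b₃ ∧ b₃.Causal b₄ ∧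
      b₁.tau b₃ = a₁.tau a₃ ∧ b₃.tau b₄ = a₃.tau a₄ ∧ b₁.tau b₄ = T ∧
      b₁.tau b₂ = a₁.tau r ∧ b₂.tau b₃ = r.tau a₃ ∧ r.tau a₄ < b₂.tau b₄ := by
  have h₁₃ := causal_trans h₁ h₃
  obtain ⟨c, p₁, p₄, c₁, c₄, hG, hch⟩ := exists_chart (causal_trans h₁₃ h₃₄) (hlt.trans hT)
  obtain ⟨z, cr⟩ := hch r h₁ (causal_trans h₃ h₃₄)
  obtain ⟨p₃, c₃⟩ := hch a₃ h₁₃ h₃₄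
  have bz := c₁.between c₄ cr h₁ (causal_trans h₃ h₃₄)
  have b₃ := c₁.between c₄ c₃ h₁₃ h₃₄
  have bz' := c₁.between c₃ cr h₁ h₃
  have hG₁₃ := hG.sub hG.between_left b₃ b₃.fst_left b₃.snd_left
  have hG₁r := hG.sub hG.between_left bz bz.fst_left bz.snd_left
  have hGr₃ := hG.sub bz b₃ bz'.fst_right bz'.snd_right
  have hGr₄ := hG.sub bz hG.between_right bz.fst_right bz.snd_right
  have hG₃₄ := hG.sub b₃ hG.between_right b₃.fst_right b₃.snd_right
  obtain ⟨l₁, l₂⟩ := (c₁.tau_pos_iff c₃ hG₁₃).1 hpos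
  obtain ⟨α, β, hα, hβ, hcomb, -, hαpos⟩ :=
    hG₁₃.exists_isComb l₁ l₂ bz' ((c₁.det3_eq_zero_iff c₃ cr).1 hs)
  have hα' : 0 < α := by
    rcases hαpos with e | e
    · rw [cr.tau_pos_iff c₃ hGr₃, e] at hr
      exact absurd hr.1 (lt_irrefl _)
    · exact e.1
  obtain ⟨θ₁, θ₂, hθ₁, hθ₂, hθ, e₁, e₂, e⟩ := hcomb.exists_add hα hβ hG₁₃ bz'
  obtain ⟨B, hB, eB, tB⟩ := c₃.tau_eq c₄ hG₃₄
  obtain ⟨ψ, hψ, eψ, tψ⟩ := c₁.tau_eq c₄ hG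
  obtain ⟨χ, hχ, eχ, tχ⟩ := cr.tau_eq c₄ hGr₄
  have t₁₃ := c₁.tau_eq_ofReal c₃ hG₁₃ hθ e
  have t₁r := c₁.tau_eq_ofReal cr hG₁r hθ₁ e₁
  have tr₃ := cr.tau_eq_ofReal c₃ hGr₃ hθ₂ e₂
  obtain ⟨φ, hφ₀, rfl⟩ : ∃ φ, 0 ≤ φ ∧ T = ENNReal.ofReal (2 * φ) :=
    ⟨T.toReal / 2, by positivity, by
      rw [mul_div_cancel₀ _ two_ne_zero, ENNReal.ofReal_toReal hT.ne_top]⟩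
  have hφ : InRange K φ := (ofReal_two_mul_lt_finiteDiameter_iff hφ₀).1 hT
  have hψφ : ψ < φ := by
    rw [tψ] at hlt
    have := (ENNReal.ofReal_lt_ofReal_iff_of_nonneg (by linarith [hψ.1])).1 hlt
    linarith
  have hABφ : θ₁ + θ₂ + B ≤ φ := by
    rw [t₁₃, tB, ← ENNReal.ofReal_add (by linarith [hθ.1]) (by linarith [hB.1]),
      ENNReal.ofReal_le_ofReal_iff (by linarith)] at hge
    linarith
  have hθpos : 0 < θ₁ + θ₂ := by
    rw [t₁₃, ENNReal.ofReal_pos] at hpos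
    linarith
  obtain ⟨w, hw₁, hw₂, hGw, ew, ew'⟩ := exists_good_triangle hφ hθpos hB.1 hABφ
  -- The new triangle has its middle vertex at the origin and its first side on the diagonal. The
  -- generalised tangents `k` and `j` of the half-lengths locate its first vertex `(-k, -k)` and the
  -- marked point `(-j, -j)`.
  set k := sn K (θ₁ + θ₂) / cs K (θ₁ + θ₂) with hk
  set j := sn K θ₂ / cs K θ₂ with hj
  have cθ := hθ.cs_pos
  have cθ₂ := hθ₂.cs_pos
  have hsk : sn K (θ₁ + θ₂) = k * cs K (θ₁ + θ₂) := by rw [hk, div_mul_cancel₀ _ cθ.ne']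
  have hsj : sn K θ₂ = j * cs K θ₂ := by rw [hj, div_mul_cancel₀ _ cθ₂.ne']
  have qk := cs_sq K (θ₁ + θ₂)
  have qj := cs_sq K θ₂
  rw [hsk] at qk
  rw [hsj] at qj
  have hk₀ : 0 < k := by
    have := hθ.sn_sq_pos_iff.2 hθpos
    refine div_pos (lt_of_le_of_ne hθ.sn_nonneg fun e => ?_) cθ
    rw [← e] at this
    norm_num at this
  have hj₀ : 0 ≤ j := div_nonneg hθ₂.sn_nonneg cθ₂.le
  have hsθ₁ : sn K θ₁ = (k - j) * (cs K (θ₁ + θ₂) * cs K θ₂) := by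
    have f₁ := sn_add K θ₁ θ₂
    have f₂ := cs_add K θ₁ θ₂
    have f₃ := cs_sq K θ₂
    linear_combination (-cs K θ₂) * f₁ + sn K θ₂ * f₂ - sn K θ₁ * f₃ + cs K θ₂ * hsk -
      cs K (θ₁ + θ₂) * hsj
  have hjk : j ≤ k := by
    have : 0 ≤ (k - j) * (cs K (θ₁ + θ₂) * cs K θ₂) := hsθ₁ ▸ hθ₁.sn_nonneg
    linarith [nonneg_of_mul_nonneg_left this (mul_pos cθ cθ₂)]
  have B₃ : Between (-k, -k) w (0, 0) :=
    ⟨by dsimp only; linarith, hw₁, by dsimp only; linarith, hw₂⟩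
  have B₂ : Between (-k, -k) w (-j, -j) := ⟨by dsimp only; linarith, by dsimp only; linarith,
    by dsimp only; linarith, by dsimp only; linarith⟩
  have B₂' : Between (-k, -k) (0, 0) (-j, -j) := ⟨by dsimp only; linarith, by dsimp only; linarith,
    by dsimp only; linarith, by dsimp only; linarith⟩
  have G₁₃ := hGw.sub hGw.between_left B₃ B₃.fst_left B₃.snd_left
  have G₁₂ := hGw.sub hGw.between_left B₂ B₂.fst_left B₂.snd_left
  have G₂₃ := hGw.sub B₂ B₃ B₂'.fst_right B₂'.snd_right
  have G₂₄ := hGw.sub B₂ hGw.between_right B₂.fst_right B₂.snd_right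
  have G₃₄ := hGw.sub B₃ hGw.between_right B₃.fst_right B₃.snd_right
  have ch₁₃ : chord (ep K) (-k, -k) (0, 0) = sn K (θ₁ + θ₂) ^ 2 := by
    have hw : 0 < wt (ep K) (-k, -k) := G₁₃.left
    rw [chord, show wt (ep K) (0, 0) = 1 by simp [wt], hsk, div_eq_iff (by positivity)]
    simp only [wt]
    linear_combination -k ^ 2 * qk
  have ch₂₃ : chord (ep K) (-j, -j) (0, 0) = sn K θ₂ ^ 2 := by
    have hw : 0 < wt (ep K) (-j, -j) := G₂₃.left
    rw [chord, show wt (ep K) (0, 0) = 1 by simp [wt], hsj, div_eq_iff (by positivity)]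
    simp only [wt]
    linear_combination -j ^ 2 * qj
  have ch₁₂ : chord (ep K) (-k, -k) (-j, -j) = sn K θ₁ ^ 2 := by
    have hw : 0 < wt (ep K) (-k, -k) := G₁₃.left
    have hw' : 0 < wt (ep K) (-j, -j) := G₂₃.left
    rw [chord, hsθ₁, div_eq_iff (by positivity)]
    simp only [wt]
    linear_combination -(k - j) ^ 2 * cs K θ₂ ^ 2 * (1 + ep K * j ^ 2) * qk - (k - j) ^ 2 * qj
  have C : IsComb (ep K) (j / k) (1 - ep K * j ^ 2 - j / k * (1 - ep K * k ^ 2)) (-k, -k) (0, 0)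
      (-j, -j) := by
    constructor
    · simp only [co]
      ring
    · dsimp only
      field_simp
      ring
    · dsimp only
      field_simp
      ring
  obtain ⟨b₁, d₁⟩ := exists_isChart K 0 hGw.left
  obtain ⟨b₂, d₂⟩ := exists_isChart K 0 G₂₃.left
  obtain ⟨b₃', d₃⟩ := exists_isChart K 0 G₃₄.left
  obtain ⟨b₄, d₄⟩ := exists_isChart K 0 hGw.right
  refine ⟨b₁, b₂, b₃', b₄, (d₁.causal_iff d₂).2 ⟨G₁₂.fst_le, G₁₂.snd_le⟩,
    (d₂.causal_iff d₃).2 ⟨G₂₃.fst_le, G₂₃.snd_le⟩, (d₃.causal_iff d₄).2 ⟨G₃₄.fst_le, G₃₄.snd_le⟩,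
    ?_, ?_, d₁.tau_eq_ofReal d₄ hGw hφ ew'.symm, ?_, ?_, ?_⟩
  · rw [d₁.tau_eq_ofReal d₃ G₁₃ hθ ch₁₃.symm, t₁₃]
  · rw [d₃.tau_eq_ofReal d₄ G₃₄ hB ew.symm, tB]
  · rw [d₁.tau_eq_ofReal d₂ G₁₂ hθ₁ ch₁₂.symm, t₁r]
  · rw [d₂.tau_eq_ofReal d₃ G₂₃ hθ₂ ch₂₃.symm, tr₃]
  · obtain ⟨χ', hχ', eχ', tχ'⟩ := d₂.tau_eq d₄ G₂₄
    suffices χ < χ' by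
      rw [tχ, tχ', ENNReal.ofReal_lt_ofReal_iff_of_nonneg (by linarith [hχ.1])]
      linarith
    rw [← hχ.sn_sq_lt_iff hχ', eχ, eχ']
    have hC : 0 ≤ 1 - ep K * j ^ 2 - j / k * (1 - ep K * k ^ 2) := by
      have h₁ : 0 ≤ 1 - j / k := sub_nonneg.2 ((div_le_one hk₀).2 hjk)
      have h₂ : 0 < 1 + ep K * (-k) * (-j) := G₁₂.corner
      have h₃ : 1 - ep K * j ^ 2 - j / k * (1 - ep K * k ^ 2) =
          (1 - j / k) * (1 + ep K * (-k) * (-j)) := by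
        field_simp
        ring
      rw [h₃]
      positivity
    -- Stewart's coefficients depend only on lengths along the first side, which agree in both
    -- triangles. Only the chord from the first to the last vertex has grown, and its coefficient is
    -- positive because `r ≠ a₃`.
    obtain ⟨k₁, l₁, m₁, -, -, hl₁, s₁, st₁⟩ := hcomb.stewart hα hβ (hG.wt_pos hG.between_left)
      (hG.wt_pos b₃) (hG.wt_pos bz)
    obtain ⟨k₂, l₂, m₂, -, -, -, s₂, st₂⟩ := C.stewart (by positivity) hC
      (hGw.wt_pos hGw.between_left) (hGw.wt_pos B₃) (hGw.wt_pos B₂)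
    have f₁ := st₁ _ (hG.wt_pos hG.between_left)
    have f₂ := st₁ _ (hG.wt_pos b₃)
    have f₃ := st₁ _ (hG.wt_pos hG.between_right)
    have g₁ := st₂ _ (hGw.wt_pos hGw.between_left)
    have g₂ := st₂ _ (hGw.wt_pos B₃)
    have g₃ := st₂ _ (hGw.wt_pos hGw.between_right)
    rw [chord_self, mul_zero, add_zero, chord_comm _ z, chord_comm _ p₃, ← e₁, ← e] at f₁
    rw [chord_self, mul_zero, add_zero, ← e₂, ← e] at f₂
    rw [chord_self, mul_zero, add_zero, chord_comm _ (-j, -j), chord_comm _ (0, 0), ch₁₂,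
      ch₁₃] at g₁
    rw [chord_self, mul_zero, add_zero, ch₂₃, ch₁₃] at g₂
    obtain ⟨hk', hl', hm'⟩ := stewart_unique (hθ.sn_sq_pos_iff.2 hθpos) hθ.sn_sq_lt s₁ f₁ f₂
      s₂ g₁ g₂
    rw [f₃, g₃, ew', ew, ← eB, ← eψ, ← hk', ← hl', ← hm']
    have := mul_lt_mul_of_pos_left ((hψ.sn_sq_lt_iff hφ).2 hψφ) (hl₁ hα')
    linarith

end NullChart

/-! ### From triangle comparison to the four-point condition -/

namespace NullChart

open LorentzianPreLengthSpace (Causal Chron tau)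
open Filter Topology

theorem tau_self {K : ℝ} (a : LorentzModel K) : a.tau a = 0 := by
  rw [LorentzModel.tau, if_pos (causal_refl a)]
  simp only [sub_self, zero_add, Real.cos_zero]
  split_ifs with h₁ h₂ h₃
  · simp
  · have := Real.cos_pos_of_mem_Ioo (abs_lt.1 (a.t_lt h₂))
    rw [show (1 - Real.sin a.t * Real.sin a.t) / (Real.cos a.t * Real.cos a.t) = 1 by
      rw [div_eq_one_iff_eq (by positivity)]
      linear_combination -Real.sin_sq_add_cos_sq a.t]
    simp
  · have hK : K < 0 := lt_of_le_of_ne (not_lt.1 h₂) h₁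
    have := Real.cos_pos_of_mem_Ioo (abs_lt.1 (a.x_lt hK))
    rw [show (1 - Real.sin a.x * Real.sin a.x) / (Real.cos a.x * Real.cos a.x) = 1 by
      rw [div_eq_one_iff_eq (by positivity)]
      linear_combination -Real.sin_sq_add_cos_sq a.x]
    simp
  · have hK : K < 0 := lt_of_le_of_ne (not_lt.1 h₂) h₁
    refine absurd ?_ h₃
    have := abs_lt.1 (a.x_lt hK)
    rw [abs_le]
    constructor <;> linarith

/-! ### Time separation along geodesics in a Lorentzian pre-length space -/

section Space

variable {X : Type*} [LorentzianPreLengthSpace X] {x y z p : X}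

theorem chron_of_tau_pos (h : 0 < tau x y) : Chron x y :=
  (LorentzianPreLengthSpace.tau_pos_iff x y).1 h

theorem tau_pos_of_chron (h : Chron x y) : 0 < tau x y :=
  (LorentzianPreLengthSpace.tau_pos_iff x y).2 h

theorem causal_of_chron (h : Chron x y) : Causal x y :=
  LorentzianPreLengthSpace.causal_of_chron x y h

theorem tau_le_left (h : Causal x y) (h' : Causal y z) : tau x y ≤ tau x z :=
  le_self_add.trans (LorentzianPreLengthSpace.tau_triangle x y z h h')

theorem tau_le_right (h : Causal x y) (h' : Causal y z) : tau y z ≤ tau x z :=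
  le_add_self.trans (LorentzianPreLengthSpace.tau_triangle x y z h h')

/-- A positive `τ(y, y)` could be added to the finite `τ(y, z)` without exceeding it. The vanishing
is needed to treat a vertex as a point of a side whose comparison point is the comparison vertex. -/
theorem tau_self_eq_zero (h : Causal x y) (h' : Causal y z) (ht : tau x z ≠ ⊤) :
    tau y y = 0 := by
  have h₁ := LorentzianPreLengthSpace.tau_triangle y y z
    (LorentzianPreLengthSpace.causal_refl y) h'
  have h₂ : tau y z ≠ ⊤ := ne_top_of_le_ne_top ht (tau_le_right h h')
  by_contra h₃
  rw [add_comm] at h₁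
  exact h₁.not_gt (ENNReal.lt_add_right h₂ h₃)

theorem tau_le_of_causal_left (h : Causal y p) (w : X) : tau p w ≤ tau y w := by
  rcases eq_or_ne (tau p w) 0 with e | e
  · rw [e]
    exact bot_le
  · exact tau_le_right h (causal_of_chron (chron_of_tau_pos (pos_iff_ne_zero.2 e)))

theorem tau_le_of_causal_right (h : Causal p y) (w : X) : tau w p ≤ tau w y := by
  rcases eq_or_ne (tau w p) 0 with e | e
  · rw [e]
    exact bot_le
  · exact tau_le_left (causal_of_chron (chron_of_tau_pos (pos_iff_ne_zero.2 e))) h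

/-- The reverse triangle inequality survives when `y ≤ p ≤ z` is known only through its effect on
`τ`: a zero summand is covered by a hypothesis, and positive summands supply the causal relations.
-/
theorem tau_add_le (h₁ : ∀ w, tau p w ≤ tau y w) (h₂ : ∀ w, tau w p ≤ tau w z) :
    tau y p + tau p z ≤ tau y z := by
  rcases eq_or_ne (tau y p) 0 with e | e
  · rw [e, zero_add]
    exact h₁ z
  rcases eq_or_ne (tau p z) 0 with e' | e'
  · rw [e', add_zero]
    exact h₂ y
  · exact LorentzianPreLengthSpace.tau_triangle y p z
      (causal_of_chron (chron_of_tau_pos (pos_iff_ne_zero.2 e)))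
      (causal_of_chron (chron_of_tau_pos (pos_iff_ne_zero.2 e')))

variable {U : Set X} {γ : ℝ → X} {s : ℝ}

theorem tau_source (hγ : IsGeodesicIn U γ x z) (hs : s ∈ Set.Icc (0 : ℝ) 1) :
    tau x (γ s) = ENNReal.ofReal s * tau x z := by
  have := hγ.tau_eq 0 ⟨le_rfl, zero_le_one⟩ s hs hs.1
  rwa [hγ.source, sub_zero] at this

theorem tau_target (hγ : IsGeodesicIn U γ x z) (hs : s ∈ Set.Icc (0 : ℝ) 1) :
    tau (γ s) z = ENNReal.ofReal (1 - s) * tau x z := by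
  have := hγ.tau_eq s hs 1 ⟨zero_le_one, le_rfl⟩ hs.2
  rwa [hγ.target] at this

theorem IsGeodesicIn.tendsto (hγ : IsGeodesicIn U γ x z) {A : Set ℝ} (hs : s ∈ Set.Icc (0 : ℝ) 1)
    (hA : A ⊆ Set.Icc 0 1) : Tendsto γ (𝓝[A] s) (𝓝 (γ s)) :=
  (hγ.continuousOn s hs).mono hA

/-- Lower semicontinuity of `τ(·, w)` along a geodesic, from the future. -/
theorem tau_le_of_later (hγ : IsGeodesicIn U γ x z) (hs₀ : 0 ≤ s) (hs₁ : s < 1)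
    (h : ∀ t, s < t → t < 1 → Chron y (γ t)) (w : X) : tau (γ s) w ≤ tau y w := by
  by_contra hlt
  have hl := LorentzianPreLengthSpace.tau_lowerSemicontinuous (γ s, w) _ (not_le.1 hlt)
  have ht : Tendsto (fun t => (γ t, w)) (𝓝[Set.Ioo s 1] s) (𝓝 (γ s, w)) :=
    (IsGeodesicIn.tendsto hγ ⟨hs₀, hs₁.le⟩
      fun t ht => ⟨hs₀.trans ht.1.le, ht.2.le⟩).prodMk_nhds tendsto_const_nhds
  have := left_nhdsWithin_Ioo_neBot hs₁
  obtain ⟨t, ht₁, ht₂⟩ := ((ht.eventually hl).and self_mem_nhdsWithin).exists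
  exact absurd (tau_le_of_causal_left (causal_of_chron (h t ht₂.1 ht₂.2)) w) (not_le.2 ht₁)

/-- Lower semicontinuity of `τ(w, ·)` along a geodesic, from the past. -/
theorem tau_le_of_earlier (hγ : IsGeodesicIn U γ x z) (hs₀ : 0 < s) (hs₁ : s ≤ 1)
    (h : ∀ t, 0 < t → t < s → Chron (γ t) y) (w : X) : tau w (γ s) ≤ tau w y := by
  by_contra hlt
  have hl := LorentzianPreLengthSpace.tau_lowerSemicontinuous (w, γ s) _ (not_le.1 hlt)
  have ht : Tendsto (fun t => (w, γ t)) (𝓝[Set.Ioo 0 s] s) (𝓝 (w, γ s)) :=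
    tendsto_const_nhds.prodMk_nhds (IsGeodesicIn.tendsto hγ ⟨hs₀.le, hs₁⟩
      fun t ht => ⟨ht.1.le, ht.2.le.trans hs₁⟩)
  have := right_nhdsWithin_Ioo_neBot hs₀
  obtain ⟨t, ht₁, ht₂⟩ := ((ht.eventually hl).and self_mem_nhdsWithin).exists
  exact absurd (tau_le_of_causal_right (causal_of_chron (h t ht₂.1 ht₂.2)) w) (not_le.2 ht₁)

end Space

/-- A point of a segment, described by its parameter. -/
theorem exists_param {K : ℝ} {a r c : LorentzModel K} (h : a.tau r + r.tau c = a.tau c)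
    (hpos : 0 < a.tau c) (ht : a.tau c ≠ ⊤) : ∃ s ∈ Set.Icc (0 : ℝ) 1,
      a.tau r = ENNReal.ofReal s * a.tau c ∧ r.tau c = ENNReal.ofReal (1 - s) * a.tau c := by
  have h₁ : a.tau r ≠ ⊤ := ne_top_of_le_ne_top ht (h ▸ le_self_add)
  have h₂ : r.tau c ≠ ⊤ := ne_top_of_le_ne_top ht (h ▸ le_add_self)
  have hc := ENNReal.toReal_pos hpos.ne' ht
  have hsum : (a.tau r).toReal + (r.tau c).toReal = (a.tau c).toReal := by
    rw [← ENNReal.toReal_add h₁ h₂, h]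
  have n₁ : 0 ≤ (a.tau r).toReal := ENNReal.toReal_nonneg
  have n₂ : 0 ≤ (r.tau c).toReal := ENNReal.toReal_nonneg
  have e₁ : a.tau c = ENNReal.ofReal (a.tau c).toReal := (ENNReal.ofReal_toReal ht).symm
  have hs : (a.tau r).toReal / (a.tau c).toReal ≤ 1 := (div_le_one hc).2 (by linarith)
  refine ⟨(a.tau r).toReal / (a.tau c).toReal, ⟨by positivity, hs⟩, ?_, ?_⟩
  · conv_rhs => rw [e₁]
    rw [← ENNReal.ofReal_mul (by positivity), ENNReal.toReal_ofReal hc.le,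
      div_mul_cancel₀ _ hc.ne', ENNReal.ofReal_toReal h₁]
  · conv_rhs => rw [e₁]
    rw [← ENNReal.ofReal_mul (sub_nonneg.2 (by rwa [ENNReal.toReal_ofReal hc.le])),
      ENNReal.toReal_ofReal hc.le, sub_mul, one_mul,
      div_mul_cancel₀ _ hc.ne', ← hsum, add_sub_cancel_left, ENNReal.ofReal_toReal h₂]

/-! ### Consequences of comparison in a single triangle -/

variable {X : Type*} [LorentzianPreLengthSpace X] {K : ℝ} {U : Set X} {S : Prop}

/-- Common form of triangle comparison and strict triangle comparison: if `S` fails, only timelike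
triangles are compared, and only their time separations. -/
structure MixedComparison (K : ℝ) (U : Set X) (S : Prop) : Prop where
  geodesic : IsDGeodesic U (finiteDiameter K)
  comparison : ∀ (x y z : X), (S ∨ Chron x y ∧ Chron y z) → ∀ (α β γ : ℝ → X),
    IsAdmissibleCausalTriangle U (finiteDiameter K) α β γ x y z →
    ∀ a b c : LorentzModel K, IsComparisonTriangle x y z a b c →
    ∀ (p q : X) (p' q' : LorentzModel K),
      OnTriangle α β γ x y z p a b c p' → OnTriangle α β γ x y z q a b c q' →
      p'.tau q' ≤ tau p q ∧ (S → p'.Causal q' → Causal p q)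

theorem MixedComparison.exists_side (H : MixedComparison K U S) {x y : X} (hx : x ∈ U)
    (hy : y ∈ U) (hD : tau x y < finiteDiameter K) :
    ∃ γ : ℝ → X, Chron x y → IsGeodesicIn U γ x y := by
  by_cases h : Chron x y
  · obtain ⟨γ, hγ⟩ := H.geodesic x hx y hy h hD
    exact ⟨γ, fun _ => hγ⟩
  · exact ⟨fun _ => x, fun h' => absurd h' h⟩

variable {x y z : X} {a b c : LorentzModel K}

/-- Vertices, size and admissibility of a causal triangle. -/
structure Admissible (K : ℝ) (U : Set X) (S : Prop) (x y z : X) : Prop where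
  mem₁ : x ∈ U
  mem₂ : y ∈ U
  mem₃ : z ∈ U
  causal₁₂ : Causal x y
  causal₂₃ : Causal y z
  chron_or : Chron x y ∨ Chron y z
  size : tau x z < finiteDiameter K
  mixed : S ∨ Chron x y ∧ Chron y z

theorem Admissible.chron (h : Admissible K U S x y z) : Chron x z := by
  apply chron_of_tau_pos
  rcases h.chron_or with h' | h'
  · exact (tau_pos_of_chron h').trans_le (tau_le_left h.causal₁₂ h.causal₂₃)
  · exact (tau_pos_of_chron h').trans_le (tau_le_right h.causal₁₂ h.causal₂₃)

theorem Admissible.size₁₂ (h : Admissible K U S x y z) : tau x y < finiteDiameter K :=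
  (tau_le_left h.causal₁₂ h.causal₂₃).trans_lt h.size

theorem Admissible.size₂₃ (h : Admissible K U S x y z) : tau y z < finiteDiameter K :=
  (tau_le_right h.causal₁₂ h.causal₂₃).trans_lt h.size

/-- A point of a geodesic and its comparison point, given by a common parameter. -/
theorem isComparisonPoint_of_param {γ : ℝ → X} (hγ : IsGeodesicIn U γ x z) {s : ℝ}
    (hs : s ∈ Set.Icc (0 : ℝ) 1) {r : LorentzModel K} (h₁ : a.Causal r) (h₂ : r.Causal c)
    (e : a.tau c = tau x z) (e₁ : a.tau r = ENNReal.ofReal s * a.tau c)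
    (e₂ : r.tau c = ENNReal.ofReal (1 - s) * a.tau c) :
    IsComparisonPoint x z (γ s) a c r :=
  ⟨h₁, h₂, by rw [e₁, e, tau_source hγ hs], by rw [e₂, e, tau_target hγ hs]⟩

/-- Comparison between the middle vertex and a point of the longest side. -/
theorem MixedComparison.vertex (H : MixedComparison K U S) (hA : Admissible K U S x y z)
    (hT : IsComparisonTriangle x y z a b c) {γ : ℝ → X} (hγ : IsGeodesicIn U γ x z) {s : ℝ}
    (hs : s ∈ Set.Icc (0 : ℝ) 1) {r : LorentzModel K} (h₁ : a.Causal r) (h₂ : r.Causal c)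
    (e₁ : a.tau r = ENNReal.ofReal s * a.tau c)
    (e₂ : r.tau c = ENNReal.ofReal (1 - s) * a.tau c) :
    (b.tau r ≤ tau y (γ s) ∧ (S → b.Causal r → Causal y (γ s))) ∧
      (r.tau b ≤ tau (γ s) y ∧ (S → r.Causal b → Causal (γ s) y)) := by
  obtain ⟨α, hα⟩ := H.exists_side hA.mem₁ hA.mem₂ hA.size₁₂
  obtain ⟨β, hβ⟩ := H.exists_side hA.mem₂ hA.mem₃ hA.size₂₃
  have htri : IsAdmissibleCausalTriangle U (finiteDiameter K) α β γ x y z :=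
    ⟨hA.mem₁, hA.mem₂, hA.mem₃, hA.causal₁₂, hA.causal₂₃, hA.chron_or, hA.size, hα, hβ, hγ⟩
  have hp : OnTriangle α β γ x y z (γ s) a b c r := Or.inr (Or.inr ⟨hA.chron, ⟨s, hs, rfl⟩,
    isComparisonPoint_of_param hγ hs h₁ h₂ hT.tau₁₃ e₁ e₂⟩)
  have hself : b.tau b = tau y y := by
    rw [tau_self, tau_self_eq_zero hA.causal₁₂ hA.causal₂₃ hA.size.ne_top]
  -- The middle vertex is taken as an endpoint of whichever adjacent side is timelike.
  have hy : OnTriangle α β γ x y z y a b c b := by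
    rcases hA.chron_or with h | h
    · exact Or.inl ⟨h, ⟨1, ⟨zero_le_one, le_rfl⟩, (hα h).target⟩, hT.causal₁₂, causal_refl b,
        hT.tau₁₂, hself⟩
    · exact Or.inr (Or.inl ⟨h, ⟨0, ⟨le_rfl, zero_le_one⟩, (hβ h).source⟩, causal_refl b,
        hT.causal₂₃, hself, hT.tau₂₃⟩)
  exact ⟨H.comparison x y z hA.mixed α β γ htri a b c hT _ _ _ _ hy hp,
    H.comparison x y z hA.mixed α β γ htri a b c hT _ _ _ _ hp hy⟩

/-- If the comparison point of a point of the longest side is in the future of the middle vertex,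
or equal to it, then the point is, as far as time separations go, in the future of the middle
vertex. -/
theorem MixedComparison.tau_le_left (H : MixedComparison K U S) (hA : Admissible K U S x y z)
    (hT : IsComparisonTriangle x y z a b c) {γ : ℝ → X} (hγ : IsGeodesicIn U γ x z) {s : ℝ}
    (hs : s ∈ Set.Icc (0 : ℝ) 1) {r : LorentzModel K} (h₁ : a.Causal r) (h₂ : r.Causal c)
    (e₁ : a.tau r = ENNReal.ofReal s * a.tau c)
    (e₂ : r.tau c = ENNReal.ofReal (1 - s) * a.tau c) (hside : LorentzModel.side a c r = 0)
    (h : r = b ∨ 0 < b.tau r) (w : X) : tau (γ s) w ≤ tau y w := by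
  rcases h with rfl | h
  · rcases hA.mixed with hS | hS
    · exact tau_le_of_causal_left ((H.vertex hA hT hγ hs h₁ h₂ e₁ e₂).1.2 hS (causal_refl r)) w
    -- Here `y` and `γ s` have the same comparison point, so comparison yields no relation between
    -- them. Points `γ t` with `t > s` have comparison points strictly later than `b`, so `y ≪ γ t`,
    -- and lower semicontinuity lets `t` tend to `s`.
    · have hs₁ : s < 1 := by
        have := tau_pos_of_chron hS.2
        rw [← hT.tau₂₃, e₂, ENNReal.mul_pos_iff, ENNReal.ofReal_pos] at this
        linarith [this.1]
      refine tau_le_of_later hγ hs.1 hs₁ (fun t ht ht' => ?_) w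
      obtain ⟨r', i₁, i₂, i₃, i₄, i₅⟩ := exists_later h₁ h₂ hside
        (hT.tau₁₃ ▸ tau_pos_of_chron hA.chron) (hT.tau₁₃ ▸ hA.size) ht ht'.le hs.1 e₁
      exact chron_of_tau_pos (i₃.trans_le
        (H.vertex hA hT hγ ⟨hs.1.trans ht.le, ht'.le⟩ i₁ i₂ i₄ i₅).1.1)
  · exact tau_le_of_causal_left (causal_of_chron (chron_of_tau_pos
      (h.trans_le (H.vertex hA hT hγ hs h₁ h₂ e₁ e₂).1.1))) w

/-- The time dual of `MixedComparison.tau_le_left`. -/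
theorem MixedComparison.tau_le_right (H : MixedComparison K U S) (hA : Admissible K U S x y z)
    (hT : IsComparisonTriangle x y z a b c) {γ : ℝ → X} (hγ : IsGeodesicIn U γ x z) {s : ℝ}
    (hs : s ∈ Set.Icc (0 : ℝ) 1) {r : LorentzModel K} (h₁ : a.Causal r) (h₂ : r.Causal c)
    (e₁ : a.tau r = ENNReal.ofReal s * a.tau c)
    (e₂ : r.tau c = ENNReal.ofReal (1 - s) * a.tau c) (hside : LorentzModel.side a c r = 0)
    (h : r = b ∨ 0 < r.tau b) (w : X) : tau w (γ s) ≤ tau w y := by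
  rcases h with rfl | h
  · rcases hA.mixed with hS | hS
    · exact tau_le_of_causal_right ((H.vertex hA hT hγ hs h₁ h₂ e₁ e₂).2.2 hS (causal_refl r)) w
    · have hs₀ : 0 < s := by
        have := tau_pos_of_chron hS.1
        rw [← hT.tau₁₂, e₁, ENNReal.mul_pos_iff, ENNReal.ofReal_pos] at this
        exact this.1
      refine tau_le_of_earlier hγ hs₀ hs.2 (fun t ht ht' => ?_) w
      obtain ⟨r', i₁, i₂, i₃, i₄, i₅⟩ := exists_earlier h₁ h₂ hside
        (hT.tau₁₃ ▸ tau_pos_of_chron hA.chron) (hT.tau₁₃ ▸ hA.size) ht' ht.le hs.2 e₂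
      exact chron_of_tau_pos (i₃.trans_le
        (H.vertex hA hT hγ ⟨ht.le, ht'.le.trans hs.2⟩ i₁ i₂ i₄ i₅).2.1)
  · exact tau_le_of_causal_right (causal_of_chron (chron_of_tau_pos
      (h.trans_le (H.vertex hA hT hγ hs h₁ h₂ e₁ e₂).2.1))) w

/-- Comparison between the last vertex and a point of the first side. -/
theorem MixedComparison.last (H : MixedComparison K U S) (hA : Admissible K U S x y z)
    (hT : IsComparisonTriangle x y z a b c) (hxy : Chron x y) {α : ℝ → X}
    (hα : IsGeodesicIn U α x y) {s : ℝ} (hs : s ∈ Set.Icc (0 : ℝ) 1) {r : LorentzModel K}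
    (h₁ : a.Causal r) (h₂ : r.Causal b) (e₁ : a.tau r = ENNReal.ofReal s * a.tau b)
    (e₂ : r.tau b = ENNReal.ofReal (1 - s) * a.tau b) : r.tau c ≤ tau (α s) z := by
  obtain ⟨β, hβ⟩ := H.exists_side hA.mem₂ hA.mem₃ hA.size₂₃
  obtain ⟨γ, hγ⟩ := H.geodesic x hA.mem₁ z hA.mem₃ hA.chron hA.size
  refine (H.comparison x y z hA.mixed α β γ ⟨hA.mem₁, hA.mem₂, hA.mem₃, hA.causal₁₂, hA.causal₂₃,
    hA.chron_or, hA.size, fun _ => hα, hβ, hγ⟩ a b c hT _ _ _ _ (Or.inl ⟨hxy, ⟨s, hs, rfl⟩,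
    isComparisonPoint_of_param hα hs h₁ h₂ hT.tau₁₂ e₁ e₂⟩) (Or.inr (Or.inr ⟨hA.chron,
    ⟨1, ⟨zero_le_one, le_rfl⟩, hγ.target⟩, causal_trans hT.causal₁₂ hT.causal₂₃, causal_refl c,
    hT.tau₁₃, ?_⟩))).1
  rw [tau_self, tau_self_eq_zero (causal_of_chron hA.chron)
    (LorentzianPreLengthSpace.causal_refl z) hA.size.ne_top]

/-- Comparison between the first vertex and a point of the second side. -/
theorem MixedComparison.first (H : MixedComparison K U S) (hA : Admissible K U S x y z)
    (hT : IsComparisonTriangle x y z a b c) (hyz : Chron y z) {β : ℝ → X}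
    (hβ : IsGeodesicIn U β y z) {s : ℝ} (hs : s ∈ Set.Icc (0 : ℝ) 1) {r : LorentzModel K}
    (h₁ : b.Causal r) (h₂ : r.Causal c) (e₁ : b.tau r = ENNReal.ofReal s * b.tau c)
    (e₂ : r.tau c = ENNReal.ofReal (1 - s) * b.tau c) : a.tau r ≤ tau x (β s) := by
  obtain ⟨α, hα⟩ := H.exists_side hA.mem₁ hA.mem₂ hA.size₁₂
  obtain ⟨γ, hγ⟩ := H.geodesic x hA.mem₁ z hA.mem₃ hA.chron hA.size
  refine (H.comparison x y z hA.mixed α β γ ⟨hA.mem₁, hA.mem₂, hA.mem₃, hA.causal₁₂, hA.causal₂₃,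
    hA.chron_or, hA.size, hα, fun _ => hβ, hγ⟩ a b c hT _ _ _ _ (Or.inr (Or.inr ⟨hA.chron,
    ⟨0, ⟨le_rfl, zero_le_one⟩, hγ.source⟩, causal_refl a, causal_trans hT.causal₁₂ hT.causal₂₃,
    ?_, hT.tau₁₃⟩)) (Or.inr (Or.inl ⟨hyz, ⟨s, hs, rfl⟩,
    isComparisonPoint_of_param hβ hs h₁ h₂ hT.tau₂₃ e₁ e₂⟩))).1
  rw [tau_self, tau_self_eq_zero (LorentzianPreLengthSpace.causal_refl x)
    (causal_of_chron hA.chron) hA.size.ne_top]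

/-! ### The two four-point inequalities -/

variable {x₁ x₂ x₃ x₄ : X} {a₁ a₂ a₃ a₄ : LorentzModel K}

/-- The four-point inequality for triangles on opposite sides of a common longest side. -/
theorem MixedComparison.opposite (H : MixedComparison K U S) (h₂ : Admissible K U S x₁ x₂ x₄)
    (h₃ : Admissible K U S x₁ x₃ x₄) (T₂ : IsComparisonTriangle x₁ x₂ x₄ a₁ a₂ a₄)
    (T₃ : IsComparisonTriangle x₁ x₃ x₄ a₁ a₃ a₄)
    (ho : LorentzModel.OppositeSides a₁ a₄ a₂ a₃) :
    (S → a₂.Causal a₃ → Causal x₂ x₃) ∧ a₂.tau a₃ ≤ tau x₂ x₃ := by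
  by_cases hc : a₂.Causal a₃
  swap
  · refine ⟨fun _ h => absurd h hc, ?_⟩
    rw [LorentzModel.tau, if_neg hc]
    exact bot_le
  have hpos : 0 < a₁.tau a₄ := T₂.tau₁₃ ▸ tau_pos_of_chron h₂.chron
  have hD : a₁.tau a₄ < finiteDiameter K := T₂.tau₁₃ ▸ h₂.size
  obtain ⟨r, i₁, i₂, hside, hadd, hadd', hdeg⟩ :=
    exists_crossing T₂.causal₁₂ hc T₃.causal₂₃ hD hpos ho
  obtain ⟨γ, hγ⟩ := H.geodesic x₁ h₂.mem₁ x₄ h₂.mem₃ h₂.chron h₂.size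
  obtain ⟨s, hs, e₁, e₂⟩ := exists_param hadd hpos hD.ne_top
  have k₁ := causal_trans T₂.causal₁₂ i₁
  have k₂ := causal_trans i₂ T₃.causal₂₃
  have v₂ := (H.vertex h₂ T₂ hγ hs k₁ k₂ e₁ e₂).1
  have v₃ := (H.vertex h₃ T₃ hγ hs k₁ k₂ e₁ e₂).2
  refine ⟨fun hS _ => LorentzianPreLengthSpace.causal_trans _ _ _ (v₂.2 hS i₁) (v₃.2 hS i₂), ?_⟩
  rcases eq_or_ne (a₂.tau a₃) 0 with h0 | h0
  · rw [h0]
    exact bot_le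
  obtain ⟨d₁, d₂⟩ := hdeg (pos_iff_ne_zero.2 h0)
  rw [← hadd']
  exact (add_le_add v₂.1 v₃.1).trans (tau_add_le
    (H.tau_le_left h₂ T₂ hγ hs k₁ k₂ e₁ e₂ hside d₁)
    (H.tau_le_right h₃ T₃ hγ hs k₁ k₂ e₁ e₂ hside d₂))

/-- The four-point inequality for triangles on the same side of a common edge. -/
theorem MixedComparison.same (H : MixedComparison K U S) (m₁ : x₁ ∈ U) (m₂ : x₂ ∈ U) (m₃ : x₃ ∈ U)
    (m₄ : x₄ ∈ U) (c₁₂ : Causal x₁ x₂) (c₂₃ : Chron x₂ x₃) (c₃₄ : Causal x₃ x₄)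
    (hS : S ∨ Chron x₁ x₂ ∧ Chron x₃ x₄) (hD : tau x₁ x₄ < finiteDiameter K)
    (T₄ : IsComparisonTriangle x₁ x₂ x₃ a₁ a₂ a₃) (T₁ : IsComparisonTriangle x₂ x₃ x₄ a₂ a₃ a₄)
    (hs : LorentzModel.SameSide a₂ a₃ a₁ a₄) : tau x₁ x₄ ≤ a₁.tau a₄ := by
  by_contra hlt
  rw [not_le] at hlt
  have k₂₃ := causal_of_chron c₂₃
  have k₁₃ := LorentzianPreLengthSpace.causal_trans _ _ _ c₁₂ k₂₃
  have k₂₄ := LorentzianPreLengthSpace.causal_trans _ _ _ k₂₃ c₃₄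
  have hD₁₃ := (NullChart.tau_le_left k₁₃ c₃₄).trans_lt hD
  have hD₂₄ := (NullChart.tau_le_right c₁₂ k₂₄).trans_lt hD
  -- Each of the four triangles is indexed by the vertex that it omits.
  have h₄ : Admissible K U S x₁ x₂ x₃ :=
    ⟨m₁, m₂, m₃, c₁₂, k₂₃, Or.inr c₂₃, hD₁₃, hS.imp_right fun h => ⟨h.1, c₂₃⟩⟩
  have h₁ : Admissible K U S x₂ x₃ x₄ :=
    ⟨m₂, m₃, m₄, k₂₃, c₃₄, Or.inl c₂₃, hD₂₄, hS.imp_right fun h => ⟨c₂₃, h.2⟩⟩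
  have h₂ : Admissible K U S x₁ x₃ x₄ :=
    ⟨m₁, m₃, m₄, k₁₃, c₃₄, Or.inl h₄.chron, hD, hS.imp_right fun h => ⟨h₄.chron, h.2⟩⟩
  have h₃ : Admissible K U S x₁ x₂ x₄ :=
    ⟨m₁, m₂, m₄, c₁₂, k₂₄, Or.inr h₁.chron, hD, hS.imp_right fun h => ⟨h.1, h₁.chron⟩⟩
  have hpos : 0 < a₂.tau a₃ := T₄.tau₂₃ ▸ tau_pos_of_chron c₂₃
  have hpos₁₃ : 0 < a₁.tau a₃ := T₄.tau₁₃ ▸ tau_pos_of_chron h₄.chron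
  have hpos₂₄ : 0 < a₂.tau a₄ := T₁.tau₁₃ ▸ tau_pos_of_chron h₁.chron
  obtain ⟨r, i₁, i₂, s₁₃, s₂₄, hadd₁₃, hadd₂₄, d₂, d₃⟩ := exists_diagonal_crossing T₄.causal₁₂
    T₄.causal₂₃ T₁.causal₂₃ hpos (hlt.trans hD) hs
  have l₁ := causal_trans T₄.causal₁₂ i₁
  have l₂ := causal_trans i₂ T₁.causal₂₃
  rcases d₃ with rfl | d₃
  -- When `r = a₃`, lengthening `x₁x₄` gains nothing at `r` on the side `x₁x₃`. But `a₃` then lies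
  -- on `[a₂, a₄]`, and time reversal gives the gain there: the point `γ s` has `τ(x₁, γ s) > τ(x₁,
  -- x₃)`, against `hB`.
  · obtain ⟨b₄, b₃, b₂, b₁, j₁, j₂, j₃, t₁, t₂, t₃, t₄, t₅, t₆⟩ := exists_longer_triangle
      (causal_rev.2 l₂) (causal_rev.2 i₁) (causal_rev.2 T₄.causal₁₂)
      ((side_rev a₂ a₄ r).trans s₂₄) (by rwa [tau_rev]) (by rwa [tau_rev]) hD
      (by rwa [tau_rev])
      (by
        rw [tau_rev, tau_rev, T₁.tau₁₃, T₄.tau₁₂, add_comm]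
        exact LorentzianPreLengthSpace.tau_triangle _ _ _ c₁₂ k₂₄)
    simp only [tau_rev] at t₁ t₂ t₄ t₅ t₆
    obtain ⟨γ, hγ⟩ := H.geodesic x₂ m₂ x₄ m₄ h₁.chron hD₂₄
    obtain ⟨s, hs, e₁, e₂⟩ := exists_param hadd₂₄ hpos₂₄ (T₁.tau₁₃ ▸ hD₂₄.ne_top)
    have hB := H.tau_le_right h₁ T₁ hγ hs i₁ l₂ e₁ e₂ s₂₄ (Or.inl rfl) x₁
    have hT : IsComparisonTriangle x₁ x₂ x₄ (rev b₁) (rev b₂) (rev b₄) :=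
      ⟨causal_rev.2 j₃, causal_rev.2 (causal_trans j₁ j₂), by rw [tau_rev, t₂, T₄.tau₁₂],
        by rw [tau_rev, t₁, T₁.tau₁₃], by rw [tau_rev, t₃]⟩
    have hF := H.first h₃ hT h₁.chron hγ hs (causal_rev.2 j₂) (causal_rev.2 j₁)
      (by rw [tau_rev, tau_rev, t₅, t₁, e₁]) (by rw [tau_rev, tau_rev, t₄, t₁, e₂])
    rw [tau_rev] at hF
    have := (t₆.trans_le hF).trans_le hB
    rw [T₄.tau₁₃] at this
    exact this.false
  · obtain ⟨b₁, b₂, b₃, b₄, j₁, j₂, j₃, t₁, t₂, t₃, t₄, t₅, t₆⟩ := exists_longer_triangle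
      l₁ i₂ T₁.causal₂₃ s₁₃ hpos₁₃ d₃ hD hlt
      (by
        rw [T₄.tau₁₃, T₁.tau₂₃]
        exact LorentzianPreLengthSpace.tau_triangle _ _ _ k₁₃ c₃₄)
    obtain ⟨γ, hγ⟩ := H.geodesic x₁ m₁ x₃ m₃ h₄.chron hD₁₃
    obtain ⟨s, hs, e₁, e₂⟩ := exists_param hadd₁₃ hpos₁₃ (T₄.tau₁₃ ▸ hD₁₃.ne_top)
    have hV := (H.vertex h₄ T₄ hγ hs l₁ i₂ e₁ e₂).1.1
    have hB := H.tau_le_left h₄ T₄ hγ hs l₁ i₂ e₁ e₂ s₁₃ d₂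
    have hT : IsComparisonTriangle x₁ x₃ x₄ b₁ b₃ b₄ :=
      ⟨causal_trans j₁ j₂, j₃, by rw [t₁, T₄.tau₁₃], by rw [t₂, T₁.tau₂₃], t₃⟩
    have hF := H.last h₂ hT h₄.chron hγ hs j₁ j₂ (by rw [t₄, t₁, e₁]) (by rw [t₅, t₁, e₂])
    have hlt' := t₆.trans_le hF
    have hp : Chron (γ s) x₄ := chron_of_tau_pos (bot_le.trans_lt hlt')
    have hsum := tau_add_le hB (tau_le_of_causal_right (causal_of_chron hp))
    -- Finiteness is what preserves the strict inequality when this term is added in `ENNReal`.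
    have hfin : a₂.tau r ≠ ⊤ := by
      refine ne_top_of_le_ne_top hD₂₄.ne_top ?_
      rw [← T₁.tau₁₃, ← hadd₂₄]
      exact le_self_add
    have := (ENNReal.add_lt_add_of_le_of_lt hfin hV hlt').trans_le hsum
    rw [hadd₂₄, T₁.tau₁₃] at this
    exact this.false

theorem _root_.TriangleComparison.mixed (h : TriangleComparison K U) :
    MixedComparison K U False where
  geodesic := h.geodesic
  comparison x y z hxyz α β γ ht a b c hT p q p' q' hp hq := by
    obtain ⟨h₁, h₂⟩ := hxyz.resolve_left id
    exact ⟨h.comparison x y z α β γ ⟨h₁, h₂, ht.size, ht.side₁₂ h₁, ht.side₂₃ h₂, ht.side₁₃⟩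
      a b c hT p q p' q' hp hq, False.elim⟩

theorem _root_.StrictTriangleComparison.mixed (h : StrictTriangleComparison K U) :
    MixedComparison K U True where
  geodesic := h.geodesic
  comparison x y z _ α β γ ht a b c hT p q p' q' hp hq := by
    obtain ⟨h₁, h₂⟩ := h.comparison x y z α β γ ht a b c hT p q p' q' hp hq
    exact ⟨h₁, fun _ => h₂⟩

end NullChart

end

theorem mainTheorem2 {X : Type*} [LorentzianPreLengthSpace X] (K : ℝ) (U : Set X) :
    (TriangleComparison K U → FourPointCondition K U) ∧
      (StrictTriangleComparison K U → StrictFourPointCondition K U) := by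
  refine ⟨fun h => ⟨h.isOpen, h.tau_continuous, ?_, ?_⟩,
    fun h => ⟨h.isOpen, h.tau_continuous, ?_, ?_⟩⟩
  · intro x₁ m₁ x₂ m₂ x₃ m₃ x₄ m₄ _ hD h₁₂ h₂₄ h₁₃ h₃₄ a₁ a₂ a₃ a₄ T₂ T₃ ho
    exact (h.mixed.opposite
      ⟨m₁, m₂, m₄, NullChart.causal_of_chron h₁₂, NullChart.causal_of_chron h₂₄, Or.inl h₁₂, hD, Or.inr ⟨h₁₂, h₂₄⟩⟩
      ⟨m₁, m₃, m₄, NullChart.causal_of_chron h₁₃, NullChart.causal_of_chron h₃₄, Or.inl h₁₃, hD, Or.inr ⟨h₁₃, h₃₄⟩⟩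
      T₂ T₃ ho).2
  · intro x₁ m₁ x₂ m₂ x₃ m₃ x₄ m₄ h₁₂ h₂₃ h₃₄ hD a₁ a₂ a₃ a₄ T₄ T₁ hs
    exact h.mixed.same m₁ m₂ m₃ m₄ (NullChart.causal_of_chron h₁₂) h₂₃ (NullChart.causal_of_chron h₃₄)
      (Or.inr ⟨h₁₂, h₃₄⟩) hD T₄ T₁ hs
  · intro x₁ m₁ x₂ m₂ x₃ m₃ x₄ m₄ _ hD h₂ h₃ a₁ a₂ a₃ a₄ T₂ T₃ ho
    have key : ∀ y ∈ U, LorentzianPreLengthSpace.Chron x₁ y ∧ LorentzianPreLengthSpace.Causal y x₄ ∨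
        LorentzianPreLengthSpace.Causal x₁ y ∧ LorentzianPreLengthSpace.Chron y x₄ →
        NullChart.Admissible K U True x₁ y x₄ := by
      rintro y hy (⟨h, h'⟩ | ⟨h, h'⟩)
      · exact ⟨m₁, hy, m₄, NullChart.causal_of_chron h, h', Or.inl h, hD, Or.inl trivial⟩
      · exact ⟨m₁, hy, m₄, h, NullChart.causal_of_chron h', Or.inr h', hD, Or.inl trivial⟩
    obtain ⟨i₁, i₂⟩ := h.mixed.opposite (key x₂ m₂ h₂) (key x₃ m₃ h₃) T₂ T₃ ho
    exact ⟨i₁ trivial, i₂⟩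
  · intro x₁ m₁ x₂ m₂ x₃ m₃ x₄ m₄ h₁₂ h₂₃ h₃₄ hD a₁ a₂ a₃ a₄ T₄ T₁ hs
    exact h.mixed.same m₁ m₂ m₃ m₄ h₁₂ h₂₃ h₃₄ (Or.inl trivial) hD T₄ T₁ hs
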